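/- Thompson's group $F$ is the group, under composition $(fg)(x)=f(g(x))$, of orientation-preserving piecewise linear homeomorphisms of $[0,1]$ with finitely many breakpoints, all at dyadic rationals, and all slopes powers of $2$. Let $x_0,x_1\in F$ be given by $$x_0(x)=\begin{cases}x/2,&0\le x\le \tfrac12\\ x-\tfrac14,&\tfrac12\le x\le\tfrac34\\ 2x-1,&\tfrac34\le x\le 1\end{cases}\qquad x_1(x)=\begin{cases}x,&0\le x\le\tfrac12\\ \tfrac12+\tfrac12x_0(2x-1),&\tfrac12\le x\le 1.\end{cases}$$ The support of $g\in F$ is the closure of $\{x: g(x)\ne x\}$. A marked group on $k$ generators is a group together with an ordered generating $k$-tuple; let $\mathcal G_k$ be the space of these up to isomorphism of marked groups, with the metric in which the distance between two marked groups is the infimum of the numbers $e^{-R}$, $R\in\{0,1,2,\dots\}$, such that they have the same relations of length at most $R$ (as words in the free group on $k$ letters). **Theorem.** For each $n\in\mathbb N$ let $[r_n,s_n]\subseteq[0,1]$ with $r_n<s_n<2r_n$, and suppose $r_n\to0$ as $n\to\infty$. Let $g_n\in F$ be nontrivial elements with support contained in $[r_n,s_n]$, and let $w_n$ be a word in $a^{\pm1},b^{\pm1}$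 with $w_n(x_0,x_1)=g_n$. Put $R_1=[ba^{-1},a^{-1}ba]$, $R_2=[ba^{-1},a^{-2}ba^2]$ and $$G_n=\langle a,b,c\mid R_1,\ R_2,\ c^{-1}w_n(a,b)\rangle .$$ Then the sequence $(G_n,\{a,b,c\})$ converges in $\mathcal G_3$ to $(G,\{a,b,c\})$, where $$G=\langle a,b,c\mid R_1,\ R_2,\ [a^ica^{-i},c],\ [a^iba^{-i},c]\ \text{ for every } i\in\mathbb Z\rangle .$$ -/

import Mathlib

open Filter Topology
open scoped commutatorElement

/-! ### Thompson's group `F` -/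

/-- Dyadic rational numbers, as a predicate on the reals. -/
def IsDyadic (q : ℝ) : Prop := ∃ (m : ℤ) (n : ℕ), q = m / 2 ^ n

theorem isDyadic_int (m : ℤ) : IsDyadic m := ⟨m, 0, by simp⟩

theorem IsDyadic.add {p q : ℝ} (hp : IsDyadic p) (hq : IsDyadic q) : IsDyadic (p + q) := by
  obtain ⟨a, m, rfl⟩ := hp
  obtain ⟨b, n, rfl⟩ := hq
  refine ⟨a * 2 ^ n + b * 2 ^ m, m + n, ?_⟩
  push_cast
  field_simp
  ring

theorem IsDyadic.mul {p q : ℝ} (hp : IsDyadic p) (hq : IsDyadic q) : IsDyadic (p * q) := by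
  obtain ⟨a, m, rfl⟩ := hp
  obtain ⟨b, n, rfl⟩ := hq
  refine ⟨a * b, m + n, ?_⟩
  push_cast
  field_simp
  ring

theorem IsDyadic.neg {p : ℝ} (hp : IsDyadic p) : IsDyadic (-p) := by
  obtain ⟨a, m, rfl⟩ := hp
  exact ⟨-a, m, by push_cast; ring⟩

theorem isDyadic_two_zpow (k : ℤ) : IsDyadic ((2 : ℝ) ^ k) := by
  obtain ⟨n, rfl | rfl⟩ := k.eq_nat_or_neg
  · exact ⟨2 ^ n, 0, by simp⟩
  · exact ⟨1, n, by simp⟩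

/-- `f` is piecewise linear on `[0,1]`, all its breakpoints lie in the finite set `S`, and all its
slopes are powers of `2`: on each interval `[u,v]` whose interior misses `S`, the map `f` is affine
with slope `2 ^ k` for some integer `k`. -/
def PiecewiseLinearOff (S : Finset unitInterval) (f : unitInterval → unitInterval) : Prop :=
  ∀ u v : unitInterval, (∀ s ∈ S, s ∉ Set.Ioo u v) →
    ∃ k : ℤ, ∀ x ∈ Set.Icc u v, ∀ y ∈ Set.Icc u v,
      (f y : ℝ) - f x = (2 : ℝ) ^ k * ((y : ℝ) - x)

/-- Membership in Thompson's group: an orientation-preserving piecewise linear homeomorphism of the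
unit interval with finitely many breakpoints, all dyadic, and slopes powers of `2`.
(The images of the breakpoints are then dyadic as well, see `IsThompson.isDyadic`.) -/
def IsThompson (f : unitInterval ≃ₜ unitInterval) : Prop :=
  StrictMono f ∧ ∃ S : Finset unitInterval,
    (∀ s ∈ S, IsDyadic (s : ℝ)) ∧ PiecewiseLinearOff S f

theorem StrictMono.homeo_zero {f : unitInterval ≃ₜ unitInterval} (hf : StrictMono f) :
    f 0 = 0 := by
  have h : f 0 ≤ f (f.symm 0) := hf.monotone unitInterval.nonneg'
  rw [f.apply_symm_apply] at h
  exact le_antisymm h unitInterval.nonneg'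

theorem IsThompson.isDyadic {f : unitInterval ≃ₜ unitInterval} (hf : IsThompson f)
    (x : unitInterval) : IsDyadic (x : ℝ) → IsDyadic (f x : ℝ) := by
  classical
  obtain ⟨hm, S, hS, hP⟩ := hf
  have key : ∀ (n : ℕ) (x : unitInterval), (S.filter (· < x)).card = n →
      IsDyadic (x : ℝ) → IsDyadic (f x : ℝ) := by
    intro n
    induction n using Nat.strong_induction_on with
    | _ n ih =>
      intro x hn hx
      rcases (S.filter (· < x)).eq_empty_or_nonempty with he | hne
      · obtain ⟨k, hk⟩ := hP 0 x (by
          intro s hs hs'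
          have : s ∈ S.filter (· < x) := Finset.mem_filter.2 ⟨hs, hs'.2⟩
          simp [he] at this)
        have h0 : (0 : unitInterval) ≤ x := unitInterval.nonneg'
        have := hk 0 ⟨le_rfl, h0⟩ x ⟨h0, le_rfl⟩
        rw [hm.homeo_zero] at this
        simp only [Set.Icc.coe_zero, sub_zero] at this
        rw [this]
        exact (isDyadic_two_zpow k).mul hx
      · set t := (S.filter (· < x)).max' hne with ht
        have htm : t ∈ S.filter (· < x) := Finset.max'_mem _ _
        obtain ⟨htS, htx⟩ := Finset.mem_filter.1 htm
        obtain ⟨k, hk⟩ := hP t x (by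
          intro s hs hs'
          have h2 : s ∈ S.filter (· < x) := Finset.mem_filter.2 ⟨hs, hs'.2⟩
          exact absurd (Finset.le_max' _ s h2) (not_le.2 hs'.1))
        have e := hk t ⟨le_rfl, htx.le⟩ x ⟨htx.le, le_rfl⟩
        have hlt : (S.filter (· < t)).card < n := by
          rw [← hn]
          apply Finset.card_lt_card
          refine ⟨fun s hs => ?_, fun h => ?_⟩
          · rw [Finset.mem_filter] at hs ⊢
            exact ⟨hs.1, hs.2.trans htx⟩
          · exact lt_irrefl t (Finset.mem_filter.1 (h htm)).2
        have hd := ih _ hlt t rfl (hS t htS)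
        have e2 : (f x : ℝ) = f t + (2 : ℝ) ^ k * ((x : ℝ) + -t) := by linarith
        rw [e2]
        exact hd.add ((isDyadic_two_zpow k).mul (hx.add (hS t htS).neg))
  exact key _ x rfl

theorem IsThompson.one : IsThompson 1 :=
  ⟨strictMono_id, ∅, by simp, fun _ _ _ => ⟨0, fun x _ y _ => by simp⟩⟩

theorem StrictMono.homeo_symm {f : unitInterval ≃ₜ unitInterval} (hf : StrictMono f) :
    StrictMono f.symm := by
  intro x y hxy
  rw [← hf.lt_iff_lt]
  simpa using hxy

theorem IsThompson.inv {f : unitInterval ≃ₜ unitInterval} (hf : IsThompson f) :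
    IsThompson f⁻¹ := by
  classical
  have hf' := hf
  obtain ⟨hm, S, hS, hP⟩ := hf
  have hi : StrictMono f.symm := hm.homeo_symm
  refine ⟨hi, S.image f, ?_, ?_⟩
  · intro s hs
    obtain ⟨t, ht, rfl⟩ := Finset.mem_image.1 hs
    exact hf'.isDyadic t (hS t ht)
  · intro u v huv
    obtain ⟨k, hk⟩ := hP (f.symm u) (f.symm v) (by
      intro s hs hs'
      refine huv (f s) (Finset.mem_image_of_mem _ hs) ⟨?_, ?_⟩
      · simpa using hm hs'.1
      · simpa using hm hs'.2)
    refine ⟨-k, fun x hx y hy => ?_⟩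
    have e := hk (f.symm x) ⟨hi.monotone hx.1, hi.monotone hx.2⟩ (f.symm y)
      ⟨hi.monotone hy.1, hi.monotone hy.2⟩
    simp only [Homeomorph.apply_symm_apply] at e
    change ((f.symm y : ℝ)) - f.symm x = _
    rw [e, zpow_neg, inv_mul_cancel_left₀ (by positivity)]

theorem IsThompson.mul {f g : unitInterval ≃ₜ unitInterval} (hf : IsThompson f)
    (hg : IsThompson g) : IsThompson (f * g) := by
  classical
  have hgi := hg.inv
  obtain ⟨hm, S, hS, hP⟩ := hf
  obtain ⟨hm', T, hT, hQ⟩ := hg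
  refine ⟨hm.comp hm', T ∪ S.image g.symm, ?_, ?_⟩
  · intro s hs
    rcases Finset.mem_union.1 hs with h | h
    · exact hT s h
    · obtain ⟨t, ht, rfl⟩ := Finset.mem_image.1 h
      exact hgi.isDyadic t (hS t ht)
  · intro u v huv
    obtain ⟨k, hk⟩ := hQ u v fun s hs => huv s (Finset.mem_union_left _ hs)
    obtain ⟨l, hl⟩ := hP (g u) (g v) (by
      intro s hs hs'
      refine huv (g.symm s)
        (Finset.mem_union_right _ (Finset.mem_image_of_mem _ hs)) ⟨?_, ?_⟩
      · simpa using hm'.homeo_symm hs'.1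
      · simpa using hm'.homeo_symm hs'.2)
    refine ⟨l + k, fun x hx y hy => ?_⟩
    have e1 := hk x hx y hy
    have e2 := hl (g x) ⟨hm'.monotone hx.1, hm'.monotone hx.2⟩ (g y)
      ⟨hm'.monotone hy.1, hm'.monotone hy.2⟩
    change ((f (g y) : ℝ)) - f (g x) = _
    rw [e2, e1, zpow_add₀ (by norm_num), mul_assoc]

/-- Thompson's group `F`, as a subgroup of the group of homeomorphisms of `[0,1]`. Multiplication
is composition: `(f * g) x = f (g x)`. -/
def ThompsonF : Subgroup (unitInterval ≃ₜ unitInterval) where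
  carrier := {f | IsThompson f}
  one_mem' := IsThompson.one
  mul_mem' := IsThompson.mul
  inv_mem' := IsThompson.inv

/-- The graph of the generator `x₀`: slopes `1/2`, `1`, `2`, breakpoints `1/2` and `3/4`. -/
noncomputable def x0Fun (x : ℝ) : ℝ :=
  if x ≤ 1 / 2 then x / 2 else if x ≤ 3 / 4 then x - 1 / 4 else 2 * x - 1

/-- The inverse function of `x0Fun`. -/
noncomputable def x0Inv (y : ℝ) : ℝ :=
  if y ≤ 1 / 4 then 2 * y else if y ≤ 1 / 2 then y + 1 / 4 else (y + 1) / 2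

/-- The graph of the generator `x₁`: the identity on `[0,1/2]`, and the copy of `x₀` scaled by
`1/2` on `[1/2,1]`. -/
noncomputable def x1Fun (x : ℝ) : ℝ :=
  if x ≤ 1 / 2 then x else 1 / 2 + x0Fun (2 * x - 1) / 2

/-- The inverse function of `x1Fun`. -/
noncomputable def x1Inv (y : ℝ) : ℝ :=
  if y ≤ 1 / 2 then y else 1 / 2 + x0Inv (2 * y - 1) / 2

theorem x0Fun_mem (x : unitInterval) : x0Fun x ∈ unitInterval := by
  obtain ⟨x, h0, h1⟩ := x
  unfold x0Fun
  constructor <;> dsimp only <;> split_ifs <;> linarith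

theorem x0Inv_mem (x : unitInterval) : x0Inv x ∈ unitInterval := by
  obtain ⟨x, h0, h1⟩ := x
  unfold x0Inv
  constructor <;> dsimp only <;> split_ifs <;> linarith

theorem x1Fun_mem (x : unitInterval) : x1Fun x ∈ unitInterval := by
  obtain ⟨x, h0, h1⟩ := x
  unfold x1Fun x0Fun
  constructor <;> dsimp only <;> split_ifs <;> linarith

theorem x1Inv_mem (x : unitInterval) : x1Inv x ∈ unitInterval := by
  obtain ⟨x, h0, h1⟩ := x
  unfold x1Inv x0Inv
  constructor <;> dsimp only <;> split_ifs <;> linarith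

theorem x0Fun_strictMono : StrictMono x0Fun := by
  intro x y h
  unfold x0Fun
  split_ifs <;> linarith

theorem x1Fun_strictMono : StrictMono x1Fun := by
  intro x y h
  unfold x1Fun x0Fun
  split_ifs <;> linarith

theorem x0Fun_x0Inv (y : ℝ) : x0Fun (x0Inv y) = y := by
  unfold x0Fun x0Inv
  split_ifs <;> linarith

theorem x1Fun_x1Inv (y : ℝ) : x1Fun (x1Inv y) = y := by
  unfold x1Fun x1Inv x0Fun x0Inv
  split_ifs <;> linarith

/-- The generator `x₀` as a homeomorphism of `[0,1]`. -/
noncomputable def x0Homeo : unitInterval ≃ₜ unitInterval :=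
  (StrictMono.orderIsoOfRightInverse
    (fun x : unitInterval => (⟨x0Fun x, x0Fun_mem x⟩ : unitInterval))
    (fun _ _ h => x0Fun_strictMono h)
    (fun y : unitInterval => (⟨x0Inv y, x0Inv_mem y⟩ : unitInterval))
    (fun y => Subtype.ext (x0Fun_x0Inv y))).toHomeomorph

/-- The generator `x₁` as a homeomorphism of `[0,1]`. -/
noncomputable def x1Homeo : unitInterval ≃ₜ unitInterval :=
  (StrictMono.orderIsoOfRightInverse
    (fun x : unitInterval => (⟨x1Fun x, x1Fun_mem x⟩ : unitInterval))
    (fun _ _ h => x1Fun_strictMono h)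
    (fun y : unitInterval => (⟨x1Inv y, x1Inv_mem y⟩ : unitInterval))
    (fun y => Subtype.ext (x1Fun_x1Inv y))).toHomeomorph

theorem x0Homeo_coe (x : unitInterval) : (x0Homeo x : ℝ) = x0Fun x := rfl

theorem x1Homeo_coe (x : unitInterval) : (x1Homeo x : ℝ) = x1Fun x := rfl

theorem isThompson_x0 : IsThompson x0Homeo := by
  classical
  refine ⟨fun _ _ h => x0Fun_strictMono h,
    {⟨1 / 2, by norm_num, by norm_num⟩, ⟨3 / 4, by norm_num, by norm_num⟩}, ?_, ?_⟩
  · intro s hs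
    simp only [Finset.mem_insert, Finset.mem_singleton] at hs
    rcases hs with rfl | rfl
    · exact ⟨1, 1, by norm_num⟩
    · exact ⟨3, 2, by norm_num⟩
  · intro u v h
    have h1 := h ⟨1 / 2, by norm_num, by norm_num⟩ (by simp)
    have h2 := h ⟨3 / 4, by norm_num, by norm_num⟩ (by simp)
    simp only [Set.mem_Ioo, ← Subtype.coe_lt_coe, not_and_or, not_lt] at h1 h2
    simp only [Set.mem_Icc, ← Subtype.coe_le_coe, x0Homeo_coe]
    by_cases hv : (v : ℝ) ≤ 1 / 2
    · refine ⟨-1, fun x hx y hy => ?_⟩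
      rw [zpow_neg_one]
      unfold x0Fun
      split_ifs <;> linarith
    by_cases hv' : (v : ℝ) ≤ 3 / 4
    · have hu : 1 / 2 ≤ (u : ℝ) := h1.resolve_right hv
      refine ⟨0, fun x hx y hy => ?_⟩
      rw [zpow_zero]
      unfold x0Fun
      split_ifs <;> linarith
    · have hu : 3 / 4 ≤ (u : ℝ) := h2.resolve_right hv'
      refine ⟨1, fun x hx y hy => ?_⟩
      rw [zpow_one]
      unfold x0Fun
      split_ifs <;> linarith

theorem x1Fun_piece1 {x : ℝ} (h : x ≤ 1 / 2) : x1Fun x = x := by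
  unfold x1Fun
  exact if_pos h

theorem x1Fun_piece2 {x : ℝ} (h : 1 / 2 ≤ x) (h' : x ≤ 3 / 4) : x1Fun x = x / 2 + 1 / 4 := by
  unfold x1Fun x0Fun
  split_ifs <;> linarith

theorem x1Fun_piece3 {x : ℝ} (h : 3 / 4 ≤ x) (h' : x ≤ 7 / 8) : x1Fun x = x - 1 / 8 := by
  unfold x1Fun x0Fun
  split_ifs <;> linarith

theorem x1Fun_piece4 {x : ℝ} (h : 7 / 8 ≤ x) : x1Fun x = 2 * x - 1 := by
  unfold x1Fun x0Fun
  split_ifs <;> linarith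

theorem isThompson_x1 : IsThompson x1Homeo := by
  classical
  refine ⟨fun _ _ h => x1Fun_strictMono h,
    {⟨1 / 2, by norm_num, by norm_num⟩, ⟨3 / 4, by norm_num, by norm_num⟩,
      ⟨7 / 8, by norm_num, by norm_num⟩}, ?_, ?_⟩
  · intro s hs
    simp only [Finset.mem_insert, Finset.mem_singleton] at hs
    rcases hs with rfl | rfl | rfl
    · exact ⟨1, 1, by norm_num⟩
    · exact ⟨3, 2, by norm_num⟩
    · exact ⟨7, 3, by norm_num⟩
  · intro u v h
    have h1 := h ⟨1 / 2, by norm_num, by norm_num⟩ (by simp)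
    have h2 := h ⟨3 / 4, by norm_num, by norm_num⟩ (by simp)
    have h3 := h ⟨7 / 8, by norm_num, by norm_num⟩ (by simp)
    simp only [Set.mem_Ioo, ← Subtype.coe_lt_coe, not_and_or, not_lt] at h1 h2 h3
    simp only [Set.mem_Icc, ← Subtype.coe_le_coe, x1Homeo_coe]
    by_cases hv : (v : ℝ) ≤ 1 / 2
    · refine ⟨0, fun x hx y hy => ?_⟩
      rw [zpow_zero]
      rw [x1Fun_piece1 (hx.2.trans hv), x1Fun_piece1 (hy.2.trans hv)]
      ring
    have hu := h1.resolve_right hv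
    by_cases hv' : (v : ℝ) ≤ 3 / 4
    · refine ⟨-1, fun x hx y hy => ?_⟩
      rw [zpow_neg_one]
      rw [x1Fun_piece2 (hu.trans hx.1) (hx.2.trans hv'), x1Fun_piece2 (hu.trans hy.1) (hy.2.trans hv')]
      ring
    have hu' := h2.resolve_right hv'
    by_cases hv'' : (v : ℝ) ≤ 7 / 8
    · refine ⟨0, fun x hx y hy => ?_⟩
      rw [zpow_zero]
      rw [x1Fun_piece3 (hu'.trans hx.1) (hx.2.trans hv''), x1Fun_piece3 (hu'.trans hy.1) (hy.2.trans hv'')]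
      ring
    · have hu'' := h3.resolve_right hv''
      refine ⟨1, fun x hx y hy => ?_⟩
      rw [zpow_one]
      rw [x1Fun_piece4 (hu''.trans hx.1), x1Fun_piece4 (hu''.trans hy.1)]
      ring

/-- The generator `x₀` of Thompson's group. -/
noncomputable def thompsonX0 : ThompsonF := ⟨x0Homeo, isThompson_x0⟩

/-- The generator `x₁` of Thompson's group. -/
noncomputable def thompsonX1 : ThompsonF := ⟨x1Homeo, isThompson_x1⟩

/-- The support of an element of `F`: the closure (as a set of reals) of the set of points of
`[0,1]` that it moves. -/
def thompsonSupport (g : ThompsonF) : Set ℝ :=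
  closure (Subtype.val '' {x : unitInterval | g.1 x ≠ x})

/-- `w ↦ w(x₀, x₁)`, for `w` a word in two letters and their inverses. -/
noncomputable def evalInF : FreeGroup (Fin 2) →* ThompsonF :=
  FreeGroup.lift ![thompsonX0, thompsonX1]

/-! ### The space of marked groups -/

/-- A group marked by an ordered `k`-tuple of generators. A group with `k` generators is countable,
so groups whose carrier is in `Type` suffice up to isomorphism. -/
structure MarkedGroup (k : ℕ) : Type 1 where
  carrier : Type
  [group : Group carrier]
  gen : Fin k → carrier
  closure_gen : Subgroup.closure (Set.range gen) = ⊤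

attribute [instance] MarkedGroup.group

/-- Isomorphism of marked groups: a group isomorphism that carries the `i`-th generator to the
`i`-th generator. -/
instance MarkedGroup.setoid (k : ℕ) : Setoid (MarkedGroup k) where
  r G H := ∃ e : G.carrier ≃* H.carrier, ∀ i, e (G.gen i) = H.gen i
  iseqv :=
    { refl := fun G => ⟨MulEquiv.refl _, fun _ => rfl⟩
      symm := fun ⟨e, he⟩ => ⟨e.symm, fun i => by rw [← he i, e.symm_apply_apply]⟩
      trans := fun ⟨e, he⟩ ⟨f, hf⟩ => ⟨e.trans f, fun i => by
        rw [MulEquiv.trans_apply, he i, hf i]⟩ }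

/-- The space `𝒢_k` of groups marked by `k` elements, up to isomorphism of marked groups. -/
def MarkedSpace (k : ℕ) : Type 1 := Quotient (MarkedGroup.setoid k)

/-- The canonical epimorphism from the free group on `k` letters. -/
def MarkedGroup.canonicalHom {k : ℕ} (G : MarkedGroup k) : FreeGroup (Fin k) →* G.carrier :=
  FreeGroup.lift G.gen

theorem MarkedGroup.canonicalHom_surjective {k : ℕ} (G : MarkedGroup k) :
    Function.Surjective G.canonicalHom := by
  rw [← MonoidHom.range_eq_top, MarkedGroup.canonicalHom, FreeGroup.range_lift_eq_closure,
    G.closure_gen]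

theorem MarkedGroup.ker_eq_of_equiv {k : ℕ} {G H : MarkedGroup k} (h : G ≈ H) :
    G.canonicalHom.ker = H.canonicalHom.ker := by
  obtain ⟨e, he⟩ := h
  have : e.toMonoidHom.comp G.canonicalHom = H.canonicalHom := by
    ext i
    simp [MarkedGroup.canonicalHom, he]
  rw [← this]
  ext w
  simp [MonoidHom.mem_ker]

theorem MarkedGroup.equiv_of_ker_eq {k : ℕ} {G H : MarkedGroup k}
    (h : G.canonicalHom.ker = H.canonicalHom.ker) : G ≈ H := by
  refine ⟨((QuotientGroup.quotientKerEquivOfSurjective _ G.canonicalHom_surjective).symm.trans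
    (QuotientGroup.quotientMulEquivOfEq h)).trans
    (QuotientGroup.quotientKerEquivOfSurjective _ H.canonicalHom_surjective), fun i => ?_⟩
  have hG : G.gen i = QuotientGroup.quotientKerEquivOfSurjective _ G.canonicalHom_surjective
      (QuotientGroup.mk (FreeGroup.of i)) := by
    change _ = G.canonicalHom (FreeGroup.of i)
    simp [MarkedGroup.canonicalHom]
  rw [MulEquiv.trans_apply, MulEquiv.trans_apply, hG, MulEquiv.symm_apply_apply]
  change H.canonicalHom (FreeGroup.of i) = H.gen i
  simp [MarkedGroup.canonicalHom]

/-- The relations of a marked group: the words in the free group on `k` letters that are trivial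
in it. -/
def MarkedSpace.relations {k : ℕ} (X : MarkedSpace k) : Subgroup (FreeGroup (Fin k)) :=
  Quotient.lift (fun G : MarkedGroup k => G.canonicalHom.ker)
    (fun _ _ h => MarkedGroup.ker_eq_of_equiv h) X

theorem MarkedSpace.relations_injective {k : ℕ} :
    Function.Injective (MarkedSpace.relations (k := k)) := by
  intro X Y
  induction X using Quotient.inductionOn with | _ G
  induction Y using Quotient.inductionOn with | _ H
  intro h
  exact Quotient.sound (MarkedGroup.equiv_of_ker_eq h)

/-- The two marked groups have the same relations of length at most `R`. -/
def MarkedSpace.SameRelations {k : ℕ} (X Y : MarkedSpace k) (R : ℕ) : Prop :=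
  ∀ w : FreeGroup (Fin k), w.norm ≤ R → (w ∈ X.relations ↔ w ∈ Y.relations)

/-- The distance on `𝒢_k`: the infimum of the numbers `e ^ (-R)` over the `R` such that the two
marked groups have the same relations of length at most `R`. -/
noncomputable def MarkedSpace.distance {k : ℕ} (X Y : MarkedSpace k) : ℝ :=
  sInf {t | ∃ R : ℕ, X.SameRelations Y R ∧ t = Real.exp (-R)}

theorem MarkedSpace.sameRelations_zero {k : ℕ} (X Y : MarkedSpace k) : X.SameRelations Y 0 := by
  intro w hw
  rw [FreeGroup.norm_eq_zero.1 (Nat.le_zero.1 hw)]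
  simp [one_mem]

theorem MarkedSpace.bddBelow_distance {k : ℕ} (X Y : MarkedSpace k) :
    BddBelow {t | ∃ R : ℕ, X.SameRelations Y R ∧ t = Real.exp (-R)} := by
  refine ⟨0, ?_⟩
  rintro _ ⟨R, -, rfl⟩
  positivity

theorem MarkedSpace.nonempty_distance {k : ℕ} (X Y : MarkedSpace k) :
    {t | ∃ R : ℕ, X.SameRelations Y R ∧ t = Real.exp (-R)}.Nonempty :=
  ⟨_, 0, X.sameRelations_zero Y, rfl⟩

theorem MarkedSpace.distance_le_iff {k : ℕ} (X Y : MarkedSpace k) (R : ℕ) :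
    X.distance Y ≤ Real.exp (-R) ↔ X.SameRelations Y R := by
  refine ⟨fun h => ?_, fun h => csInf_le (X.bddBelow_distance Y) ⟨R, h, rfl⟩⟩
  have h' : X.distance Y < Real.exp (-R + 1) :=
    h.trans_lt (Real.exp_lt_exp.2 (by linarith))
  obtain ⟨_, ⟨Q, hQ, rfl⟩, hlt⟩ := exists_lt_of_csInf_lt (X.nonempty_distance Y) h'
  have hRQ : R ≤ Q := by
    have h1 : -(Q : ℝ) < -R + 1 := Real.exp_lt_exp.1 hlt
    have h2 : (R : ℝ) < Q + 1 := by linarith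
    exact Nat.lt_succ_iff.1 (by exact_mod_cast h2)
  exact fun w hw => hQ w (hw.trans hRQ)

theorem MarkedSpace.distance_nonneg {k : ℕ} (X Y : MarkedSpace k) : 0 ≤ X.distance Y := by
  apply Real.sInf_nonneg
  rintro _ ⟨R, -, rfl⟩
  positivity

theorem MarkedSpace.distance_eq_zero_iff {k : ℕ} (X Y : MarkedSpace k) :
    X.distance Y = 0 ↔ ∀ R, X.SameRelations Y R := by
  refine ⟨fun h R => (X.distance_le_iff Y R).1 (h ▸ (Real.exp_pos _).le), fun h => ?_⟩
  refine le_antisymm ?_ (X.distance_nonneg Y)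
  refine ge_of_tendsto' (x := atTop) (f := fun R : ℕ => Real.exp (-R)) ?_
    fun R => (X.distance_le_iff Y R).2 (h R)
  exact Real.tendsto_exp_neg_atTop_nhds_zero.comp tendsto_natCast_atTop_atTop

noncomputable instance (k : ℕ) : MetricSpace (MarkedSpace k) where
  dist := MarkedSpace.distance
  dist_self X := (X.distance_eq_zero_iff X).2 fun _ _ _ => Iff.rfl
  dist_comm X Y := by
    simp only [MarkedSpace.distance, MarkedSpace.SameRelations, Iff.comm]
  dist_triangle X Y Z := by
    have key : ∀ ⦃s⦄, s ∈ {t | ∃ R : ℕ, X.SameRelations Y R ∧ t = Real.exp (-R)} →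
        X.distance Z - Y.distance Z ≤ s := by
      rintro _ ⟨R, hR, rfl⟩
      have key2 : ∀ ⦃s⦄, s ∈ {t | ∃ R : ℕ, Y.SameRelations Z R ∧ t = Real.exp (-R)} →
          X.distance Z - Real.exp (-R) ≤ s := by
        rintro _ ⟨Q, hQ, rfl⟩
        have h : X.SameRelations Z (min R Q) := fun w hw =>
          (hR w (hw.trans (min_le_left _ _))).trans (hQ w (hw.trans (min_le_right _ _)))
        have h' := (X.distance_le_iff Z _).2 h
        have p1 := Real.exp_pos (-(R : ℝ))
        have p2 := Real.exp_pos (-(Q : ℝ))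
        rcases min_choice R Q with e | e <;> rw [e] at h' <;> linarith
      have := le_csInf (Y.nonempty_distance Z) key2
      change X.distance Z - Real.exp (-R) ≤ Y.distance Z at this
      linarith
    have := le_csInf (X.nonempty_distance Y) key
    change X.distance Z - Y.distance Z ≤ X.distance Y at this
    change X.distance Z ≤ X.distance Y + Y.distance Z
    linarith
  eq_of_dist_eq_zero {X Y} h := by
    apply MarkedSpace.relations_injective
    ext w
    exact (X.distance_eq_zero_iff Y).1 h w.norm w le_rfl

/-- The group `⟨x_1, …, x_k | rels⟩`, marked by its `k` generators, as a point of `𝒢_k`. -/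
def presentedMarked {k : ℕ} (rels : Set (FreeGroup (Fin k))) : MarkedSpace k :=
  Quotient.mk _
    { carrier := PresentedGroup rels
      gen := PresentedGroup.of
      closure_gen := PresentedGroup.closure_range_of rels }

/-! ### The presentations -/

/-- The free generators `a`, `b`, `c`. -/
def genA : FreeGroup (Fin 3) := FreeGroup.of 0

/-- See `genA`. -/
def genB : FreeGroup (Fin 3) := FreeGroup.of 1

/-- See `genA`. -/
def genC : FreeGroup (Fin 3) := FreeGroup.of 2

/-- `R₁ = [b a⁻¹, a⁻¹ b a]`. -/
def relR1 : FreeGroup (Fin 3) := ⁅genB * genA⁻¹, genA⁻¹ * genB * genA⁆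

/-- `R₂ = [b a⁻¹, a⁻² b a²]`. -/
def relR2 : FreeGroup (Fin 3) := ⁅genB * genA⁻¹, (genA ^ 2)⁻¹ * genB * genA ^ 2⁆

/-- The word `w(a, b)`, for `w` a word in two letters and their inverses. -/
def wordInAB : FreeGroup (Fin 2) →* FreeGroup (Fin 3) := FreeGroup.lift ![genA, genB]

/-- The marked group `⟨a, b, c | R₁, R₂, c⁻¹ w(a, b)⟩`. -/
def markedOfWord (w : FreeGroup (Fin 2)) : MarkedSpace 3 :=
  presentedMarked {relR1, relR2, genC⁻¹ * wordInAB w}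

/-- The marked group
`⟨a, b, c | R₁, R₂, [aⁱ c a⁻ⁱ, c], [aⁱ b a⁻ⁱ, c] for every i ∈ ℤ⟩`. -/
def limitMarked : MarkedSpace 3 :=
  presentedMarked ({relR1, relR2}
    ∪ Set.range (fun i : ℤ => ⁅genA ^ i * genC * genA ^ (-i), genC⁆)
    ∪ Set.range (fun i : ℤ => ⁅genA ^ i * genB * genA ^ (-i), genC⁆))

/-! Convergence means that each fixed word `v` in `a, b, c` is, for all large `n`, trivial in `Gₙ`
exactly when it is trivial in `G` (`tendsto_markedSpace`).

The relators `R₁`, `R₂` present the subgroup of `F` generated by `x₀, x₁`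
(`lift_eq_one_of_evalInF_eq_one`): they imply the relations `x_n x_k = x_k x_{n+1}` for `k < n`,
which turn every element into a fraction of ordered positive words, and distinct ordered positive
words act differently on `[0,1]`. Hence `Gₙ` is that subgroup marked by `x₀, x₁, gₙ`, and triviality
of `v` becomes a statement about homeomorphisms (`mem_relations_markedOfWord`).

Near `0` the map `x₀` halves. As `sₙ < 2rₙ`, the translates of `[rₙ, sₙ]` under powers of `x₀` are
pairwise disjoint once `sₙ ≤ 1/2`, so the conjugates `x₀ⁱ gₙ x₀⁻ⁱ` commute; and `gₙ` commutes with
`x₀ⁱ x₁ x₀⁻ⁱ` once `sₙ ≤ x₀ⁱ(1/2)`. So each relation of `G` holds in `Gₙ` for large `n`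
(`eventually_evalAt_eq_one`).

Conversely, in `G` every element is a word in the conjugates `aⁱ c a⁻ⁱ` times a word `u(a, b)`
(`exists_limit_normalForm`). If it is trivial in infinitely many `Gₙ`, then `u(x₀, x₁)` fixes each
point of `(0,1]`, because the supports of the finitely many conjugates involved shrink to `0`; so `u
= 1`. The rest is a relation among the conjugates of `gₙ`, which are free abelian generators, so all
its exponent sums vanish and it is trivial in `G` (`limitHom_eq_one_of_frequently`). -/

/-! ### Infinite generating sequence and normal forms -/

/-- The generators of the infinite presentation of Thompson's group: `x₀ = a` and
`x_{n+1} = a⁻ⁿ b aⁿ`. -/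
def thompsonSeq {Γ : Type*} [Group Γ] (a b : Γ) : ℕ → Γ
  | 0 => a
  | n + 1 => (a ^ n)⁻¹ * b * a ^ n

section Normal

variable {Γ : Type*} [Group Γ] {a b : Γ}

theorem thompsonSeq_conj_a (n : ℕ) :
    a⁻¹ * thompsonSeq a b (n + 1) * a = thompsonSeq a b (n + 2) := by
  simp only [thompsonSeq, pow_succ]
  group

theorem thompsonSeq_conj_pow (k n : ℕ) :
    (a ^ k)⁻¹ * thompsonSeq a b (n + 1) * a ^ k = thompsonSeq a b (n + k + 1) := by
  simp only [thompsonSeq, pow_add]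
  group

/-- Commuting with `b a⁻¹` means being conjugated the same way by `a` and by `b`. From this for
`x_{n+2}`, conjugating by `a` gives `x₂⁻¹ x_{n+3} x₂ = x_{n+4}`, and `b a⁻¹` commutes with every
factor on the left. Two consecutive indices are carried because the step uses both. -/
theorem commute_mul_inv_thompsonSeq (h1 : Commute (b * a⁻¹) (a⁻¹ * b * a))
    (h2 : Commute (b * a⁻¹) ((a ^ 2)⁻¹ * b * a ^ 2)) (n : ℕ) :
    Commute (b * a⁻¹) (thompsonSeq a b (n + 2)) ∧
      Commute (b * a⁻¹) (thompsonSeq a b (n + 3)) := by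
  have e1 : thompsonSeq a b 2 = a⁻¹ * b * a := by simp [thompsonSeq]
  induction n with
  | zero => exact ⟨by rw [e1]; exact h1, h2⟩
  | succ n ih =>
    refine ⟨ih.2, ?_⟩
    have hb : b⁻¹ * thompsonSeq a b (n + 2) * b = thompsonSeq a b (n + 3) := by
      rw [← thompsonSeq_conj_a (n + 1)]
      have h : b * a⁻¹ * thompsonSeq a b (n + 2) = thompsonSeq a b (n + 2) * (b * a⁻¹) := ih.1
      calc b⁻¹ * thompsonSeq a b (n + 2) * b
          = b⁻¹ * (thompsonSeq a b (n + 2) * (b * a⁻¹)) * a := by group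
        _ = _ := by rw [← h]; group
    have key : (thompsonSeq a b 2)⁻¹ * thompsonSeq a b (n + 3) * thompsonSeq a b 2
        = thompsonSeq a b (n + 4) := by
      calc _ = (a⁻¹ * b * a)⁻¹ * (a⁻¹ * thompsonSeq a b (n + 2) * a) * (a⁻¹ * b * a) := by
            rw [e1, thompsonSeq_conj_a (n + 1)]
        _ = a⁻¹ * (b⁻¹ * thompsonSeq a b (n + 2) * b) * a := by group
        _ = _ := by rw [hb, thompsonSeq_conj_a (n + 2)]
    change Commute _ (thompsonSeq a b (n + 4))
    rw [← key]
    exact ((e1 ▸ h1).inv_right.mul_right ih.2).mul_right (e1 ▸ h1)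

/-- The defining relations of the infinite presentation. -/
theorem thompsonSeq_mul (h1 : Commute (b * a⁻¹) (a⁻¹ * b * a))
    (h2 : Commute (b * a⁻¹) ((a ^ 2)⁻¹ * b * a ^ 2)) {k n : ℕ} (hkn : k < n) :
    thompsonSeq a b n * thompsonSeq a b k = thompsonSeq a b k * thompsonSeq a b (n + 1) := by
  cases k with
  | zero =>
    obtain ⟨n, rfl⟩ : ∃ m, n = m + 1 := ⟨n - 1, by omega⟩
    rw [← thompsonSeq_conj_a]
    simp only [thompsonSeq]
    group
  | succ k =>
    -- Conjugation by a power of `a` shifts indices, so it suffices to treat the smaller index `1`,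
    -- that is, `b` itself.
    obtain ⟨m, rfl⟩ : ∃ m, n = m + 1 + k + 1 := ⟨n - k - 2, by omega⟩
    have h := (commute_mul_inv_thompsonSeq h1 h2 m).1.eq
    have hb : thompsonSeq a b (m + 2) * b = b * thompsonSeq a b (m + 3) := by
      rw [← thompsonSeq_conj_a (m + 1)]
      calc thompsonSeq a b (m + 2) * b = thompsonSeq a b (m + 2) * (b * a⁻¹) * a := by group
        _ = _ := by rw [← h]; group
    have e : m + 1 + k + 1 + 1 = (m + 2) + k + 1 := by omega
    rw [e, ← thompsonSeq_conj_pow k (m + 1), ← thompsonSeq_conj_pow k (m + 2)]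
    change _ * ((a ^ k)⁻¹ * b * a ^ k) = ((a ^ k)⁻¹ * b * a ^ k) * _
    calc _ = (a ^ k)⁻¹ * (thompsonSeq a b (m + 2) * b) * a ^ k := by group
      _ = _ := by rw [hb]; group

/-- Left multiplication of an ordered positive word by a generator gives an ordered positive
word. -/
theorem exists_sorted_cons (h1 : Commute (b * a⁻¹) (a⁻¹ * b * a))
    (h2 : Commute (b * a⁻¹) ((a ^ 2)⁻¹ * b * a ^ 2)) (L : List ℕ) (i : ℕ)
    (hL : L.Pairwise (· ≤ ·)) :
    ∃ M : List ℕ, M.Pairwise (· ≤ ·) ∧ (∀ k, k ≤ i → (∀ l ∈ L, k ≤ l) → ∀ m ∈ M, k ≤ m) ∧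
      (M.map (thompsonSeq a b)).prod = thompsonSeq a b i * (L.map (thompsonSeq a b)).prod := by
  induction L generalizing i with
  | nil => exact ⟨[i], by simp, by simp, by simp⟩
  | cons j L ih =>
    obtain ⟨hj, hL⟩ := List.pairwise_cons.1 hL
    rcases le_or_gt i j with hij | hij
    · refine ⟨i :: j :: L, ?_, by simp +contextual, by simp⟩
      simp only [List.pairwise_cons, List.mem_cons, forall_eq_or_imp]
      exact ⟨⟨hij, fun l hl => hij.trans (hj l hl)⟩, hj, hL⟩
    -- Moving `x_i` past the smaller `x_j` raises its index to `i + 1`. The lower-bound clause of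
    -- the induction then keeps `j` a valid head.
    · obtain ⟨M, hM, hk, hprod⟩ := ih (i + 1) hL
      refine ⟨j :: M, List.pairwise_cons.2 ⟨hk j (by omega) hj, hM⟩, ?_, ?_⟩
      · intro k hki hkl
        simp only [List.mem_cons, forall_eq_or_imp] at hkl ⊢
        exact ⟨hkl.1, hk k (by omega) hkl.2⟩
      · simp only [List.map_cons, List.prod_cons, hprod]
        rw [← mul_assoc, ← mul_assoc, thompsonSeq_mul h1 h2 hij]

theorem exists_sorted (h1 : Commute (b * a⁻¹) (a⁻¹ * b * a))
    (h2 : Commute (b * a⁻¹) ((a ^ 2)⁻¹ * b * a ^ 2)) (L : List ℕ) :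
    ∃ M : List ℕ, M.Pairwise (· ≤ ·) ∧
      (M.map (thompsonSeq a b)).prod = (L.map (thompsonSeq a b)).prod := by
  induction L with
  | nil => exact ⟨[], by simp, rfl⟩
  | cons i L ih =>
    obtain ⟨M, hM, h⟩ := ih
    obtain ⟨M', hM', -, h'⟩ := exists_sorted_cons h1 h2 M i hM
    exact ⟨M', hM', by rw [h', h, List.map_cons, List.prod_cons]⟩

/-- The Ore condition: a generator's inverse times a positive word is a right fraction. -/
theorem exists_inv_mul_eq (h1 : Commute (b * a⁻¹) (a⁻¹ * b * a))
    (h2 : Commute (b * a⁻¹) ((a ^ 2)⁻¹ * b * a ^ 2)) (L : List ℕ) (i : ℕ) :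
    ∃ M N : List ℕ, (thompsonSeq a b i)⁻¹ * (L.map (thompsonSeq a b)).prod
      = (M.map (thompsonSeq a b)).prod * ((N.map (thompsonSeq a b)).prod)⁻¹ := by
  induction L generalizing i with
  | nil => exact ⟨[], [i], by simp⟩
  | cons j L ih =>
    rcases lt_trichotomy i j with hij | rfl | hij
    -- For `i < j`, `x_i⁻¹ x_j = x_{j+1} x_i⁻¹`; for `j < i` below, `x_i⁻¹ x_j = x_j x_{i+1}⁻¹`.
    · obtain ⟨M, N, h⟩ := ih i
      refine ⟨(j + 1) :: M, N, ?_⟩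
      have e := thompsonSeq_mul h1 h2 hij
      rw [List.map_cons, List.prod_cons, List.map_cons, List.prod_cons, mul_assoc, ← h,
        ← mul_assoc, ← mul_assoc]
      congr 1
      rw [inv_mul_eq_iff_eq_mul, ← mul_assoc, ← e, mul_inv_cancel_right]
    · exact ⟨L, [], by simp⟩
    · obtain ⟨M, N, h⟩ := ih (i + 1)
      refine ⟨j :: M, N, ?_⟩
      have e := thompsonSeq_mul h1 h2 hij
      rw [List.map_cons, List.prod_cons, List.map_cons, List.prod_cons, mul_assoc, ← h,
        ← mul_assoc, ← mul_assoc]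
      congr 1
      rw [inv_mul_eq_iff_eq_mul, ← mul_assoc, e, mul_inv_cancel_right]

/-- Every element of the subgroup generated by `a` and `b` is a right fraction of ordered positive
words. -/
theorem exists_sorted_fraction (h1 : Commute (b * a⁻¹) (a⁻¹ * b * a))
    (h2 : Commute (b * a⁻¹) ((a ^ 2)⁻¹ * b * a ^ 2)) (u : FreeGroup (Fin 2)) :
    ∃ L M : List ℕ, L.Pairwise (· ≤ ·) ∧ M.Pairwise (· ≤ ·) ∧ FreeGroup.lift ![a, b] u
      = (L.map (thompsonSeq a b)).prod * ((M.map (thompsonSeq a b)).prod)⁻¹ := by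
  suffices h : ∃ L M : List ℕ, FreeGroup.lift ![a, b] u
      = (L.map (thompsonSeq a b)).prod * ((M.map (thompsonSeq a b)).prod)⁻¹ by
    obtain ⟨L, M, h⟩ := h
    obtain ⟨L', hL', eL⟩ := exists_sorted h1 h2 L
    obtain ⟨M', hM', eM⟩ := exists_sorted h1 h2 M
    exact ⟨L', M', hL', hM', by rw [h, eL, eM]⟩
  have hgen : ∀ i : Fin 2, (![a, b] : Fin 2 → Γ) i = thompsonSeq a b i := by
    intro i
    fin_cases i <;> simp [thompsonSeq]
  obtain ⟨l, rfl⟩ : ∃ l, FreeGroup.mk l = u := ⟨_, FreeGroup.mk_toWord⟩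
  induction l with
  | nil => exact ⟨[], [], by simp [← FreeGroup.one_eq_mk]⟩
  | cons x l ih =>
    obtain ⟨i, s⟩ := x
    obtain ⟨L, M, h⟩ := ih
    rw [← List.singleton_append, ← FreeGroup.mul_mk, map_mul, h]
    cases s with
    | true =>
      refine ⟨i :: L, M, ?_⟩
      simp [hgen, mul_assoc]
    | false =>
      obtain ⟨L', N, h'⟩ := exists_inv_mul_eq h1 h2 L i
      refine ⟨L', M ++ N, ?_⟩
      rw [← mul_assoc]
      simp only [FreeGroup.lift_mk, List.map_cons, List.map_nil, cond_false, List.prod_singleton,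
        hgen, h', List.map_append, List.prod_append, mul_inv_rev, mul_assoc]

end Normal

/-! ### Thompson's group acting on the interval -/

/-- The action of Thompson's group on the unit interval. -/
def thompsonPerm : ThompsonF →* Equiv.Perm unitInterval where
  toFun f := f.1.toEquiv
  map_one' := rfl
  map_mul' _ _ := rfl

theorem thompsonPerm_strictMono (f : ThompsonF) : StrictMono (thompsonPerm f) := f.2.1

theorem thompsonPerm_injective : Function.Injective thompsonPerm := fun _ _ h =>
  Subtype.ext (Homeomorph.ext fun x => congrArg (fun e : Equiv.Perm unitInterval => e x) h)

theorem thompsonPerm_zero (f : ThompsonF) : thompsonPerm f 0 = 0 := f.2.1.homeo_zero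

theorem thompsonPerm_one_right (f : ThompsonF) : thompsonPerm f 1 = 1 := by
  have h : thompsonPerm f (thompsonPerm f⁻¹ 1) ≤ thompsonPerm f 1 :=
    (thompsonPerm_strictMono f).monotone unitInterval.le_one'
  rw [← Equiv.Perm.mul_apply, ← map_mul, mul_inv_cancel, map_one thompsonPerm] at h
  exact le_antisymm unitInterval.le_one' h

theorem thompsonPerm_inv_apply_self (f : ThompsonF) (x : unitInterval) :
    thompsonPerm f⁻¹ (thompsonPerm f x) = x := by simp

theorem thompsonPerm_apply_inv_self (f : ThompsonF) (x : unitInterval) :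
    thompsonPerm f (thompsonPerm f⁻¹ x) = x := by simp

theorem coe_thompsonPerm_x0 (x : unitInterval) :
    (thompsonPerm thompsonX0 x : ℝ) = x0Fun x := rfl

theorem coe_thompsonPerm_x1 (x : unitInterval) :
    (thompsonPerm thompsonX1 x : ℝ) = x1Fun x := rfl

theorem thompsonPerm_x0_lt {x : unitInterval} (h0 : 0 < (x : ℝ)) (h1 : (x : ℝ) < 1) :
    thompsonPerm thompsonX0 x < x := by
  rw [← Subtype.coe_lt_coe, coe_thompsonPerm_x0]
  unfold x0Fun
  split_ifs <;> linarith

theorem thompsonPerm_x1_of_le {x : unitInterval} (h : (x : ℝ) ≤ 1 / 2) :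
    thompsonPerm thompsonX1 x = x := by
  rw [← Subtype.coe_inj, coe_thompsonPerm_x1, x1Fun_piece1 h]

theorem thompsonPerm_x1_lt {x : unitInterval} (h0 : 1 / 2 < (x : ℝ)) (h1 : (x : ℝ) < 1) :
    thompsonPerm thompsonX1 x < x := by
  rw [← Subtype.coe_lt_coe, coe_thompsonPerm_x1]
  unfold x1Fun x0Fun
  split_ifs <;> linarith

/-- The point `1 - 2⁻ⁿ`. -/
noncomputable def dyadicPoint (n : ℕ) : unitInterval :=
  ⟨1 - (1 / 2) ^ n, by
    have h1 : ((1 : ℝ) / 2) ^ n ≤ 1 := pow_le_one₀ (by norm_num) (by norm_num)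
    have h0 : (0 : ℝ) < (1 / 2) ^ n := by positivity
    constructor <;> linarith⟩

theorem dyadicPoint_strictMono : StrictMono dyadicPoint := by
  refine strictMono_nat_of_lt_succ fun n => ?_
  rw [← Subtype.coe_lt_coe]
  change (1 : ℝ) - (1 / 2) ^ n < 1 - (1 / 2) ^ (n + 1)
  have h0 : (0 : ℝ) < (1 / 2) ^ n := by positivity
  rw [pow_succ]
  linarith

theorem dyadicPoint_lt_one (n : ℕ) : dyadicPoint n < 1 := by
  rw [← Subtype.coe_lt_coe]
  change (1 : ℝ) - (1 / 2) ^ n < 1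
  have h0 : (0 : ℝ) < (1 / 2) ^ n := by positivity
  linarith

/-- Conjugating by `x₀ⁿ` thus carries the left end `1/2` of the support of `x₁` to `1 - 2⁻⁽ⁿ⁺¹⁾`,
which locates the support of `x_{n+1}`. -/
theorem thompsonPerm_x0_pow_dyadicPoint (n : ℕ) :
    thompsonPerm (thompsonX0 ^ n) (dyadicPoint (n + 1)) = dyadicPoint 1 := by
  induction n with
  | zero => simp
  | succ n ih =>
    have h : thompsonPerm thompsonX0 (dyadicPoint (n + 1 + 1)) = dyadicPoint (n + 1) := by
      rw [← Subtype.coe_inj, coe_thompsonPerm_x0]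
      change x0Fun (1 - (1 / 2) ^ (n + 1 + 1)) = 1 - (1 / 2) ^ (n + 1)
      have h1 : ((1 : ℝ) / 2) ^ n ≤ 1 := pow_le_one₀ (by norm_num) (by norm_num)
      have h0 : (0 : ℝ) < (1 / 2) ^ n := by positivity
      rw [pow_succ, pow_succ]
      unfold x0Fun
      split_ifs <;> linarith
    rw [pow_succ, map_mul, Equiv.Perm.mul_apply, h, ih]

/-- The `i`-th generator of the infinite presentation in Thompson's group. -/
noncomputable abbrev thompsonGen (i : ℕ) : ThompsonF := thompsonSeq thompsonX0 thompsonX1 i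

theorem coe_dyadicPoint_one : (dyadicPoint 1 : ℝ) = 1 / 2 := by
  change (1 : ℝ) - (1 / 2) ^ 1 = 1 / 2
  norm_num

theorem thompsonPerm_gen_of_le {i : ℕ} {x : unitInterval} (h : x ≤ dyadicPoint i) :
    thompsonPerm (thompsonGen i) x = x := by
  cases i with
  | zero =>
    have h0 : x = 0 := by
      refine le_antisymm ?_ unitInterval.nonneg'
      rw [← Subtype.coe_le_coe] at h ⊢
      exact h.trans (by change (1 : ℝ) - (1 / 2) ^ 0 ≤ 0; norm_num)
    rw [h0, thompsonPerm_zero]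
  | succ n =>
    have h' := (thompsonPerm_strictMono (thompsonX0 ^ n)).monotone h
    rw [thompsonPerm_x0_pow_dyadicPoint, ← Subtype.coe_le_coe, coe_dyadicPoint_one] at h'
    change thompsonPerm ((thompsonX0 ^ n)⁻¹ * thompsonX1 * thompsonX0 ^ n) x = x
    rw [map_mul, map_mul, Equiv.Perm.mul_apply, Equiv.Perm.mul_apply, thompsonPerm_x1_of_le h',
      thompsonPerm_inv_apply_self]

theorem thompsonPerm_gen_lt {i : ℕ} {x : unitInterval} (h : dyadicPoint i < x) (h1 : x < 1) :
    thompsonPerm (thompsonGen i) x < x := by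
  cases i with
  | zero =>
    refine thompsonPerm_x0_lt ?_ h1
    rw [← Subtype.coe_lt_coe] at h
    exact lt_of_le_of_lt (dyadicPoint 0).2.1 h
  | succ n =>
    have h' := thompsonPerm_strictMono (thompsonX0 ^ n) h
    have h1' := thompsonPerm_strictMono (thompsonX0 ^ n) h1
    rw [thompsonPerm_x0_pow_dyadicPoint, ← Subtype.coe_lt_coe, coe_dyadicPoint_one] at h'
    rw [thompsonPerm_one_right] at h1'
    change thompsonPerm ((thompsonX0 ^ n)⁻¹ * thompsonX1 * thompsonX0 ^ n) x < x
    have := thompsonPerm_strictMono (thompsonX0 ^ n)⁻¹ (thompsonPerm_x1_lt h' h1')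
    rwa [thompsonPerm_inv_apply_self] at this

theorem thompsonPerm_gen_le (i : ℕ) (x : unitInterval) :
    thompsonPerm (thompsonGen i) x ≤ x := by
  rcases le_or_gt x (dyadicPoint i) with h | h
  · exact (thompsonPerm_gen_of_le h).le
  rcases lt_or_eq_of_le (unitInterval.le_one' (t := x)) with h1 | rfl
  · exact (thompsonPerm_gen_lt h h1).le
  · exact (thompsonPerm_one_right _).le

theorem thompsonPerm_prod_le (L : List ℕ) (x : unitInterval) :
    thompsonPerm (L.map thompsonGen).prod x ≤ x := by
  induction L with
  | nil => simp
  | cons i L ih =>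
    rw [List.map_cons, List.prod_cons, map_mul, Equiv.Perm.mul_apply]
    exact (thompsonPerm_gen_le _ _).trans ih

theorem thompsonPerm_prod_of_le {j : ℕ} {L : List ℕ} (hL : ∀ l ∈ L, j ≤ l) {x : unitInterval}
    (h : x ≤ dyadicPoint j) : thompsonPerm (L.map thompsonGen).prod x = x := by
  induction L with
  | nil => simp
  | cons i L ih =>
    simp only [List.mem_cons, forall_eq_or_imp] at hL
    rw [List.map_cons, List.prod_cons, map_mul, Equiv.Perm.mul_apply, ih hL.2]
    exact thompsonPerm_gen_of_le (h.trans (dyadicPoint_strictMono.monotone hL.1))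

/-- The point `1 - 2⁻⁽ⁱ⁺¹⁾` separates the two sides: generators of index above `i` fix it, `x_i`
moves it strictly left, and no generator moves any point to the right. -/
theorem prod_thompsonGen_ne {i : ℕ} {L M : List ℕ} (hM : ∀ m ∈ M, i < m) :
    ((i :: L).map thompsonGen).prod ≠ (M.map thompsonGen).prod := by
  intro h
  have e := congrArg (fun f => thompsonPerm f (dyadicPoint (i + 1))) h
  simp only [List.map_cons, List.prod_cons, map_mul, Equiv.Perm.mul_apply] at e
  rw [thompsonPerm_prod_of_le (j := i + 1) hM le_rfl] at e
  have h1 : thompsonPerm (thompsonGen i) (thompsonPerm (L.map thompsonGen).prod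
      (dyadicPoint (i + 1))) ≤ thompsonPerm (thompsonGen i) (dyadicPoint (i + 1)) :=
    (thompsonPerm_strictMono _).monotone (thompsonPerm_prod_le _ _)
  have h2 := thompsonPerm_gen_lt (dyadicPoint_strictMono (Nat.lt_succ_self i))
    (dyadicPoint_lt_one (i + 1))
  exact absurd e (h1.trans_lt h2).ne

/-- Ordered positive words are determined by the element of Thompson's group they represent. -/
theorem sorted_eq_of_prod_eq {L M : List ℕ} (hL : L.Pairwise (· ≤ ·)) (hM : M.Pairwise (· ≤ ·))
    (h : (L.map thompsonGen).prod = (M.map thompsonGen).prod) : L = M := by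
  induction L generalizing M with
  | nil =>
    cases M with
    | nil => rfl
    | cons j M => exact absurd h.symm (prod_thompsonGen_ne (by simp))
  | cons i L ih =>
    cases M with
    | nil => exact absurd h (prod_thompsonGen_ne (by simp))
    | cons j M =>
      have hL' := List.pairwise_cons.1 hL
      have hM' := List.pairwise_cons.1 hM
      -- The heads are the least indices of the two words; unequal heads are separated by the
      -- action, equal ones cancel.
      rcases lt_trichotomy i j with hij | rfl | hij
      · refine absurd h (prod_thompsonGen_ne ?_)
        simp only [List.mem_cons, forall_eq_or_imp]
        exact ⟨hij, fun m hm => hij.trans_le (hM'.1 m hm)⟩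
      · rw [ih hL'.2 hM'.2]
        simpa using h
      · refine absurd h.symm (prod_thompsonGen_ne ?_)
        simp only [List.mem_cons, forall_eq_or_imp]
        exact ⟨hij, fun m hm => hij.trans_le (hL'.1 m hm)⟩

/-- Both generators equal `2x - 1` on `[7/8, 1]`, whose image is `[3/4, 1]`. -/
theorem thompsonPerm_x1_mul_x0_inv {x : unitInterval} (h : 3 / 4 ≤ (x : ℝ)) :
    thompsonPerm (thompsonX1 * thompsonX0⁻¹) x = x := by
  rw [map_mul, Equiv.Perm.mul_apply, ← Subtype.coe_inj, coe_thompsonPerm_x1]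
  have e : x0Fun (thompsonPerm thompsonX0⁻¹ x) = x := by
    rw [← coe_thompsonPerm_x0, thompsonPerm_apply_inv_self]
  generalize (thompsonPerm thompsonX0⁻¹ x : ℝ) = y at e
  unfold x0Fun at e
  split_ifs at e
  · linarith
  · linarith
  · rw [x1Fun_piece4 (by linarith), e]

/-- The first element moves points only in `[0, 3/4]`, the second only in `[3/4, 1]`. -/
theorem thompson_commute_gen (n : ℕ) :
    Commute (thompsonX1 * thompsonX0⁻¹) (thompsonGen (n + 2)) := by
  have h : Commute (thompsonPerm (thompsonX1 * thompsonX0⁻¹))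
      (thompsonPerm (thompsonGen (n + 2))) := by
    refine Equiv.Perm.Disjoint.commute fun x => ?_
    rcases le_total (3 / 4) (x : ℝ) with hx | hx
    · exact Or.inl (thompsonPerm_x1_mul_x0_inv hx)
    · refine Or.inr (thompsonPerm_gen_of_le (le_trans ?_
        (dyadicPoint_strictMono.monotone (Nat.le_add_left 2 n))))
      rw [← Subtype.coe_le_coe]
      exact hx.trans (by change (3 : ℝ) / 4 ≤ 1 - (1 / 2) ^ 2; norm_num)
  refine thompsonPerm_injective ?_
  rw [map_mul, map_mul thompsonPerm (thompsonGen _)]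
  exact h

theorem thompson_commute_one :
    Commute (thompsonX1 * thompsonX0⁻¹) (thompsonX0⁻¹ * thompsonX1 * thompsonX0) := by
  simpa [thompsonGen, thompsonSeq] using thompson_commute_gen 0

theorem thompson_commute_two : Commute (thompsonX1 * thompsonX0⁻¹)
    ((thompsonX0 ^ 2)⁻¹ * thompsonX1 * thompsonX0 ^ 2) := thompson_commute_gen 1

theorem map_lift_pair {Γ Δ : Type*} [Group Γ] [Group Δ] (φ : Γ →* Δ) (a b : Γ)
    (u : FreeGroup (Fin 2)) :
    φ (FreeGroup.lift ![a, b] u) = FreeGroup.lift ![φ a, φ b] u := by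
  rw [← MonoidHom.comp_apply]
  congr 1
  ext i
  fin_cases i <;> simp

/-- The two standard relations present the subgroup of `F` generated by `x₀` and `x₁`: a word that
is trivial in `F` is trivial in every group in which the relations hold. -/
theorem lift_eq_one_of_evalInF_eq_one {Γ : Type*} [Group Γ] {a b : Γ}
    (h1 : Commute (b * a⁻¹) (a⁻¹ * b * a)) (h2 : Commute (b * a⁻¹) ((a ^ 2)⁻¹ * b * a ^ 2))
    {u : FreeGroup (Fin 2)} (hu : evalInF u = 1) : FreeGroup.lift ![a, b] u = 1 := by
  -- In the product group a single pair of ordered words represents `u` in both factors: uniqueness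
  -- in `F` forces the two words to coincide, and then the component in `Γ` is trivial as well.
  let A : Γ × ThompsonF := (a, thompsonX0)
  let B : Γ × ThompsonF := (b, thompsonX1)
  have H1 : Commute (B * A⁻¹) (A⁻¹ * B * A) :=
    Prod.ext h1.eq thompson_commute_one.eq
  have H2 : Commute (B * A⁻¹) ((A ^ 2)⁻¹ * B * A ^ 2) :=
    Prod.ext h2.eq thompson_commute_two.eq
  obtain ⟨L, M, hL, hM, h⟩ := exists_sorted_fraction H1 H2 u
  have hseq : ∀ (i : ℕ), (thompsonSeq A B i).2 = thompsonGen i := by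
    rintro (_ | i) <;> rfl
  have hsnd : ∀ L : List ℕ, ((L.map (thompsonSeq A B)).prod).2 = (L.map thompsonGen).prod := by
    intro L
    induction L with
    | nil => rfl
    | cons i L ih =>
      rw [List.map_cons, List.prod_cons, List.map_cons, List.prod_cons, Prod.snd_mul, ih, hseq]
  have hLM : L = M := by
    refine sorted_eq_of_prod_eq hL hM ?_
    have e := congrArg Prod.snd h
    rw [Prod.snd_mul, Prod.snd_inv, hsnd, hsnd] at e
    have e' := map_lift_pair (MonoidHom.snd Γ ThompsonF) A B u
    change (FreeGroup.lift ![A, B] u).2 = evalInF u at e'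
    rw [e', hu] at e
    exact mul_inv_eq_one.1 e.symm
  rw [hLM, mul_inv_cancel] at h
  have e := map_lift_pair (MonoidHom.fst Γ ThompsonF) A B u
  rw [h] at e
  exact e.symm

/-! ### Elements with small support -/

theorem thompsonPerm_ne_mem_Icc {g : ThompsonF} {r s : ℝ} (h : thompsonSupport g ⊆ Set.Icc r s)
    {x : unitInterval} (hx : thompsonPerm g x ≠ x) : (x : ℝ) ∈ Set.Icc r s :=
  h (subset_closure (Set.mem_image_of_mem _ hx))

/-- The first application halves the point; further ones only move it left. -/
theorem thompsonPerm_x0_pow_succ_le (n : ℕ) {x : unitInterval} (h : (x : ℝ) ≤ 1 / 2) :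
    (thompsonPerm (thompsonX0 ^ (n + 1)) x : ℝ) ≤ x / 2 := by
  induction n with
  | zero =>
    rw [zero_add, pow_one, coe_thompsonPerm_x0, x0Fun, if_pos h]
  | succ n ih =>
    rw [pow_succ', map_mul, Equiv.Perm.mul_apply]
    exact (Subtype.coe_le_coe.2 (thompsonPerm_gen_le 0 _)).trans ih

/-- The conjugate `x₀ⁱ g x₀⁻ⁱ`. -/
noncomputable def x0Conj (g : ThompsonF) (i : ℤ) : ThompsonF :=
  thompsonX0 ^ i * g * thompsonX0 ^ (-i)

theorem thompsonPerm_x0Conj_ne {g : ThompsonF} {i : ℤ} {y : unitInterval}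
    (h : thompsonPerm (x0Conj g i) y ≠ y) :
    thompsonPerm g (thompsonPerm (thompsonX0 ^ (-i)) y) ≠ thompsonPerm (thompsonX0 ^ (-i)) y := by
  contrapose! h
  rw [x0Conj, map_mul, map_mul, Equiv.Perm.mul_apply, Equiv.Perm.mul_apply, h, zpow_neg,
    thompsonPerm_apply_inv_self]

/-- A positive power of `x₀` takes the `j`-translate of `y` to the `i`-translate and at least halves
it; if both lay in `[r, s]`, then `r ≤ s / 2 < r`. -/
theorem x0_translate_notMem {r s : ℝ} (hsr : s < 2 * r) (hs : s ≤ 1 / 2) {i j : ℤ} (hij : i < j)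
    {y : unitInterval} (hj : (thompsonPerm (thompsonX0 ^ (-j)) y : ℝ) ∈ Set.Icc r s) :
    (thompsonPerm (thompsonX0 ^ (-i)) y : ℝ) ∉ Set.Icc r s := by
  obtain ⟨n, hn⟩ : ∃ n : ℕ, j - i = n + 1 := ⟨(j - i - 1).toNat, by omega⟩
  have e : thompsonX0 ^ (-i) = thompsonX0 ^ (n + 1) * thompsonX0 ^ (-j) := by
    rw [← zpow_natCast, ← zpow_add]
    congr 1
    push_cast
    omega
  intro hi
  have h := thompsonPerm_x0_pow_succ_le n (hj.2.trans hs)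
  rw [← Equiv.Perm.mul_apply, ← map_mul, ← e] at h
  linarith [hi.1, hj.2]

theorem x0Conj_disjoint {g : ThompsonF} {r s : ℝ} (h : thompsonSupport g ⊆ Set.Icc r s)
    (hsr : s < 2 * r) (hs : s ≤ 1 / 2) {i j : ℤ} (hij : i ≠ j) :
    (thompsonPerm (x0Conj g i)).Disjoint (thompsonPerm (x0Conj g j)) := by
  intro y
  by_contra! hy
  have hi := thompsonPerm_ne_mem_Icc h (thompsonPerm_x0Conj_ne hy.1)
  have hj := thompsonPerm_ne_mem_Icc h (thompsonPerm_x0Conj_ne hy.2)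
  rcases lt_or_gt_of_ne hij with hlt | hlt
  · exact x0_translate_notMem hsr hs hlt hj hi
  · exact x0_translate_notMem hsr hs hlt hi hj

theorem commute_of_disjoint {f g : ThompsonF}
    (h : (thompsonPerm f).Disjoint (thompsonPerm g)) : Commute f g :=
  thompsonPerm_injective (by rw [map_mul, map_mul]; exact h.commute)

theorem x0Conj_zero (g : ThompsonF) : x0Conj g 0 = g := by simp [x0Conj]

theorem commute_x0Conj {g : ThompsonF} {r s : ℝ} (h : thompsonSupport g ⊆ Set.Icc r s)
    (hsr : s < 2 * r) (hs : s ≤ 1 / 2) (i : ℤ) : Commute (x0Conj g i) g := by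
  rcases eq_or_ne i 0 with rfl | hi
  · rw [x0Conj_zero]
  · have := commute_of_disjoint (x0Conj_disjoint h hsr hs hi)
    rwa [x0Conj_zero] at this

/-- The conjugate of `x₁` moves only points to the right of `x₀ⁱ(1/2)`, while `g` moves none there.
-/
theorem commute_x0Conj_x1 {g : ThompsonF} {r s : ℝ} (h : thompsonSupport g ⊆ Set.Icc r s) {i : ℤ}
    (hs : s ≤ thompsonPerm (thompsonX0 ^ i) (dyadicPoint 1)) :
    Commute (x0Conj thompsonX1 i) g := by
  refine commute_of_disjoint fun x => ?_
  by_contra! hx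
  have h1 := (thompsonPerm_ne_mem_Icc h hx.2).2.trans hs
  have h2 := thompsonPerm_x0Conj_ne hx.1
  refine h2 (thompsonPerm_x1_of_le ?_)
  have h3 := (thompsonPerm_strictMono (thompsonX0 ^ (-i))).monotone (Subtype.coe_le_coe.1 h1)
  rw [zpow_neg, thompsonPerm_inv_apply_self, ← Subtype.coe_le_coe, coe_dyadicPoint_one] at h3
  rwa [zpow_neg]

theorem thompsonPerm_pos (f : ThompsonF) {x : unitInterval} (h : 0 < x) :
    0 < thompsonPerm f x := by
  simpa [thompsonPerm_zero] using thompsonPerm_strictMono f h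

theorem x0Conj_fix {g : ThompsonF} {r s : ℝ} (h : thompsonSupport g ⊆ Set.Icc r s) {i : ℤ}
    {y : unitInterval} (hs : s < thompsonPerm (thompsonX0 ^ (-i)) y) :
    thompsonPerm (x0Conj g i) y = y := by
  by_contra hy
  exact absurd (thompsonPerm_ne_mem_Icc h (thompsonPerm_x0Conj_ne hy)).2 (not_le.2 hs)

/-! ### Increasing permutations -/

theorem lt_pow_apply_of_lt {α : Type*} [Preorder α] {f : Equiv.Perm α} (hf : StrictMono f) {x : α}
    (h : x < f x) (n : ℕ) : x < (f ^ (n + 1)) x := by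
  induction n with
  | zero => simpa
  | succ n ih =>
    rw [pow_succ', Equiv.Perm.mul_apply]
    exact h.trans (hf ih)

theorem pow_apply_lt_of_lt {α : Type*} [Preorder α] {f : Equiv.Perm α} (hf : StrictMono f) {x : α}
    (h : f x < x) (n : ℕ) : (f ^ (n + 1)) x < x := by
  induction n with
  | zero => simpa
  | succ n ih =>
    rw [pow_succ', Equiv.Perm.mul_apply]
    exact (hf ih).trans h

/-- An increasing permutation of a linear order has no periodic points other than fixed points. -/
theorem eq_zero_of_zpow_apply_eq {α : Type*} [LinearOrder α] {f : Equiv.Perm α}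
    (hf : StrictMono f) {x : α} (hx : f x ≠ x) {k : ℤ} (hk : (f ^ k) x = x) : k = 0 := by
  have key : ∀ n : ℕ, (f ^ n) x = x → n = 0 := by
    rintro (_ | n) hn
    · rfl
    · rcases lt_or_gt_of_ne hx with h | h
      · exact absurd hn (pow_apply_lt_of_lt hf h n).ne
      · exact absurd hn (lt_pow_apply_of_lt hf h n).ne'
  obtain ⟨n, rfl | rfl⟩ := k.eq_nat_or_neg
  · rw [key n (by rwa [zpow_natCast] at hk), Nat.cast_zero]
  · rw [zpow_neg, Equiv.Perm.inv_eq_iff_eq, zpow_natCast] at hk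
    rw [key n hk.symm, Nat.cast_zero, neg_zero]

/-! ### Exponent sums in a free group -/

/-- The exponent sums of a word in a free group. -/
noncomputable def exponentSum {ι : Type*} (v : FreeGroup ι) : ι →₀ ℤ :=
  FreeAbelianGroup.toFinsupp (Additive.ofMul (Abelianization.of v) : FreeAbelianGroup ι)

theorem exponentSum_mul {ι : Type*} (v w : FreeGroup ι) :
    exponentSum (v * w) = exponentSum v + exponentSum w := by
  rw [exponentSum, map_mul]
  exact map_add (FreeAbelianGroup.toFinsupp (X := ι)) _ _

theorem exponentSum_one {ι : Type*} : exponentSum (1 : FreeGroup ι) = 0 := by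
  have h := exponentSum_mul (1 : FreeGroup ι) 1
  rwa [mul_one, left_eq_add] at h

theorem exponentSum_inv {ι : Type*} (v : FreeGroup ι) : exponentSum v⁻¹ = -exponentSum v := by
  rw [eq_neg_iff_add_eq_zero, ← exponentSum_mul, inv_mul_cancel, exponentSum_one]

theorem exponentSum_of {ι : Type*} (i : ι) :
    exponentSum (FreeGroup.of i) = Finsupp.single i 1 :=
  FreeAbelianGroup.toFinsupp_of i

theorem mem_commutator_of_exponentSum_eq_zero {ι : Type*} {v : FreeGroup ι}
    (h : exponentSum v = 0) : v ∈ commutator (FreeGroup ι) := by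
  rw [← Abelianization.ker_of, MonoidHom.mem_ker]
  exact (FreeAbelianGroup.equivFinsupp ι).injective (h.trans (map_zero _).symm)

/-- A word with zero exponent sums is trivial at pairwise commuting elements. -/
theorem lift_eq_one_of_exponentSum_eq_zero {ι Γ : Type*} [Group Γ] {c : ι → Γ}
    (hc : ∀ i j, Commute (c i) (c j)) {v : FreeGroup ι} (h : exponentSum v = 0) :
    FreeGroup.lift c v = 1 := by
  have hcomm : ∀ v i, Commute (FreeGroup.lift c v) (c i) := by
    intro v i
    induction v using FreeGroup.induction_on with
    | C1 => simp
    | of j => simpa using hc j i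
    | inv_of j hj => simpa using hj
    | mul v w hv hw => rw [map_mul]; exact hv.mul_left hw
  have hcomm' : ∀ v w, Commute (FreeGroup.lift c v) (FreeGroup.lift c w) := by
    intro v w
    induction w using FreeGroup.induction_on with
    | C1 => simp
    | of j => simpa using hcomm v j
    | inv_of j hj => simpa using hj
    | mul w w' hw hw' => rw [map_mul]; exact hw.mul_right hw'
  have hle : commutator (FreeGroup ι) ≤ (FreeGroup.lift c).ker := by
    rw [commutator_def, Subgroup.commutator_le]
    intro v _ w _
    rw [MonoidHom.mem_ker, map_commutatorElement, commutatorElement_eq_one_iff_commute]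
    exact hcomm' v w
  exact hle (mem_commutator_of_exponentSum_eq_zero h)

/-- A product of disjoint permutations acts on the points moved by one of them as a power of that
one. -/
theorem lift_apply_of_disjoint {ι α : Type*} {c : ι → Equiv.Perm α}
    (hc : ∀ i j, i ≠ j → (c i).Disjoint (c j)) {j : ι} (v : FreeGroup ι) {y : α}
    (hy : c j y ≠ y) : FreeGroup.lift c v y = (c j ^ exponentSum v j) y := by
  induction v using FreeGroup.induction_on generalizing y with
  | C1 => simp [exponentSum_one]
  | of i =>
    rw [FreeGroup.lift_apply_of, exponentSum_of]
    rcases eq_or_ne i j with rfl | hij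
    · simp
    · rw [Finsupp.single_eq_of_ne hij.symm, zpow_zero]
      exact (hc i j hij y).resolve_right hy
  | inv_of i _ =>
    rw [map_inv, FreeGroup.lift_apply_of, exponentSum_inv, exponentSum_of, Finsupp.neg_apply]
    rcases eq_or_ne i j with rfl | hij
    · simp
    · rw [Finsupp.single_eq_of_ne hij.symm, neg_zero, zpow_zero, Equiv.Perm.inv_eq_iff_eq]
      exact ((hc i j hij y).resolve_right hy).symm
  | mul v w hv hw =>
    -- The powers of `c j` preserve the set of points it moves, so the hypothesis for `v` applies at
    -- the image point.
    have hy' : c j ((c j ^ exponentSum w j) y) ≠ (c j ^ exponentSum w j) y := by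
      rw [← Equiv.Perm.mul_apply, ← zpow_one_add, add_comm, zpow_add, zpow_one,
        Equiv.Perm.mul_apply]
      exact fun e => hy ((c j ^ exponentSum w j).injective e)
    rw [map_mul, Equiv.Perm.mul_apply, hw hy, hv hy', exponentSum_mul, Finsupp.add_apply, zpow_add,
      Equiv.Perm.mul_apply]

/-- The conjugates `x₀ⁱ g x₀⁻ⁱ` of an element of small support freely generate a free abelian
group. -/
theorem exponentSum_eq_zero_of_lift_x0Conj_eq_one {g : ThompsonF} (hg : g ≠ 1) {r s : ℝ}
    (h : thompsonSupport g ⊆ Set.Icc r s) (hsr : s < 2 * r) (hs : s ≤ 1 / 2) {v : FreeGroup ℤ}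
    (hv : FreeGroup.lift (x0Conj g) v = 1) : exponentSum v = 0 := by
  obtain ⟨x, hx⟩ : ∃ x, thompsonPerm g x ≠ x := by
    by_contra! hx
    exact hg (thompsonPerm_injective (Equiv.ext fun x => by rw [hx, map_one]; rfl))
  ext j
  -- Translating a point moved by `g` gives one moved by the `j`-th conjugate. There the whole
  -- product acts as a power of that conjugate, which isolates the `j`-th exponent.
  have hy : thompsonPerm (x0Conj g j) (thompsonPerm (thompsonX0 ^ j) x)
      ≠ thompsonPerm (thompsonX0 ^ j) x := by
    rw [x0Conj, map_mul, map_mul, Equiv.Perm.mul_apply, Equiv.Perm.mul_apply, zpow_neg,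
      thompsonPerm_inv_apply_self]
    exact fun e => hx ((thompsonPerm _).injective e)
  have e := lift_apply_of_disjoint (c := fun i => thompsonPerm (x0Conj g i))
    (fun _ _ hij => x0Conj_disjoint h hsr hs hij) v hy
  have e' : FreeGroup.lift (fun i => thompsonPerm (x0Conj g i)) v
      = thompsonPerm (FreeGroup.lift (x0Conj g) v) := by
    rw [← MonoidHom.comp_apply]
    congr 1
    ext i : 1
    simp
  rw [e', hv, map_one] at e
  exact eq_zero_of_zpow_apply_eq (thompsonPerm_strictMono _) hy e.symm

/-! ### Relations of the marked groups -/

theorem mem_relations_presentedMarked {k : ℕ} {rels : Set (FreeGroup (Fin k))}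
    {w : FreeGroup (Fin k)} :
    w ∈ (presentedMarked rels).relations ↔ w ∈ Subgroup.normalClosure rels := by
  have h : (FreeGroup.lift (PresentedGroup.of (rels := rels))) = PresentedGroup.mk rels := by
    ext i
    simp [PresentedGroup.of, PresentedGroup.mk]
  change w ∈ (FreeGroup.lift (PresentedGroup.of (rels := rels))).ker ↔ _
  rw [h, MonoidHom.mem_ker]
  exact QuotientGroup.eq_one_iff w

/-- Evaluation of a word in `a, b, c` at `x₀, x₁, g`. -/
noncomputable def evalAt (g : ThompsonF) : FreeGroup (Fin 3) →* ThompsonF :=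
  FreeGroup.lift ![thompsonX0, thompsonX1, g]

theorem evalAt_genA (g : ThompsonF) : evalAt g genA = thompsonX0 := by simp [evalAt, genA]

theorem evalAt_genB (g : ThompsonF) : evalAt g genB = thompsonX1 := by simp [evalAt, genB]

theorem evalAt_genC (g : ThompsonF) : evalAt g genC = g := by simp [evalAt, genC]

theorem map_wordInAB {Γ : Type*} [Group Γ] (φ : FreeGroup (Fin 3) →* Γ) (u : FreeGroup (Fin 2)) :
    φ (wordInAB u) = FreeGroup.lift ![φ genA, φ genB] u :=
  map_lift_pair φ genA genB u

theorem evalAt_wordInAB (g : ThompsonF) (u : FreeGroup (Fin 2)) :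
    evalAt g (wordInAB u) = evalInF u := by
  rw [map_wordInAB, evalAt_genA, evalAt_genB]
  rfl

theorem map_relR1_eq_one_iff {Γ : Type*} [Group Γ] (φ : FreeGroup (Fin 3) →* Γ) :
    φ relR1 = 1 ↔ Commute (φ genB * (φ genA)⁻¹) ((φ genA)⁻¹ * φ genB * φ genA) := by
  rw [relR1, map_commutatorElement, commutatorElement_eq_one_iff_commute]
  simp only [map_mul, map_inv]

theorem map_relR2_eq_one_iff {Γ : Type*} [Group Γ] (φ : FreeGroup (Fin 3) →* Γ) :
    φ relR2 = 1 ↔ Commute (φ genB * (φ genA)⁻¹) ((φ genA ^ 2)⁻¹ * φ genB * φ genA ^ 2) := by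
  rw [relR2, map_commutatorElement, commutatorElement_eq_one_iff_commute]
  simp only [map_mul, map_inv, map_pow]

theorem evalAt_relR1 (g : ThompsonF) : evalAt g relR1 = 1 := by
  rw [map_relR1_eq_one_iff, evalAt_genA, evalAt_genB]
  exact thompson_commute_one

theorem evalAt_relR2 (g : ThompsonF) : evalAt g relR2 = 1 := by
  rw [map_relR2_eq_one_iff, evalAt_genA, evalAt_genB]
  exact thompson_commute_two

theorem wordInAB_mem_of_evalInF_eq_one {N : Subgroup (FreeGroup (Fin 3))} [N.Normal]
    (h1 : relR1 ∈ N) (h2 : relR2 ∈ N) {u : FreeGroup (Fin 2)} (hu : evalInF u = 1) :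
    wordInAB u ∈ N := by
  rw [← QuotientGroup.eq_one_iff, ← QuotientGroup.mk'_apply, map_wordInAB]
  refine lift_eq_one_of_evalInF_eq_one ?_ ?_ hu
  · rw [← map_relR1_eq_one_iff]
    exact (QuotientGroup.eq_one_iff _).2 h1
  · rw [← map_relR2_eq_one_iff]
    exact (QuotientGroup.eq_one_iff _).2 h2

/-- The marked group of a word `w` is the subgroup of `F` generated by `x₀`, `x₁` and
`w(x₀, x₁)`. -/
theorem mem_relations_markedOfWord {u : FreeGroup (Fin 2)} {w : FreeGroup (Fin 3)} :
    w ∈ (markedOfWord u).relations ↔ evalAt (evalInF u) w = 1 := by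
  rw [markedOfWord, mem_relations_presentedMarked]
  set N := Subgroup.normalClosure {relR1, relR2, genC⁻¹ * wordInAB u} with hN
  have hsub : {relR1, relR2, genC⁻¹ * wordInAB u} ⊆ (N : Set (FreeGroup (Fin 3))) :=
    Subgroup.subset_normalClosure
  constructor
  · intro hw
    have hle : N ≤ (evalAt (evalInF u)).ker := by
      refine Subgroup.normalClosure_le_normal ?_
      rintro x (rfl | rfl | rfl)
      · exact evalAt_relR1 _
      · exact evalAt_relR2 _
      · change evalAt _ _ = 1
        rw [map_mul, map_inv, evalAt_genC, evalAt_wordInAB, inv_mul_cancel]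
    exact hle hw
  · intro hw
    have hC : QuotientGroup.mk' N genC = QuotientGroup.mk' N (wordInAB u) := by
      rw [← inv_mul_eq_one, ← map_inv, ← map_mul]
      exact (QuotientGroup.eq_one_iff _).2 (hsub (by simp))
    -- Substituting `u` for `c` eliminates that generator; modulo `N` this changes nothing, so only
    -- words in `a, b` remain.
    let ψ : FreeGroup (Fin 3) →* FreeGroup (Fin 2) :=
      FreeGroup.lift ![FreeGroup.of 0, FreeGroup.of 1, u]
    have hψ : (QuotientGroup.mk' N).comp (wordInAB.comp ψ) = QuotientGroup.mk' N := by
      ext i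
      fin_cases i
      · simp [ψ, wordInAB, genA]
      · simp [ψ, wordInAB, genB]
      · simpa [ψ, genC] using hC.symm
    have hψ' : evalInF.comp ψ = evalAt (evalInF u) := by
      ext1 i
      fin_cases i <;> simp [ψ, evalInF, evalAt]
    rw [← QuotientGroup.eq_one_iff, ← QuotientGroup.mk'_apply, ← hψ]
    refine (QuotientGroup.eq_one_iff _).2 (wordInAB_mem_of_evalInF_eq_one
      (hsub (by simp)) (hsub (by simp)) ?_)
    rw [← hw, ← hψ']
    rfl

/-! ### The limit group -/

/-- The relators of the limit group. -/
def limitRels : Set (FreeGroup (Fin 3)) :=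
  {relR1, relR2} ∪ Set.range (fun i : ℤ => ⁅genA ^ i * genC * genA ^ (-i), genC⁆)
    ∪ Set.range (fun i : ℤ => ⁅genA ^ i * genB * genA ^ (-i), genC⁆)

/-- The word `aⁱ c a⁻ⁱ`. -/
def conjC (i : ℤ) : FreeGroup (Fin 3) := genA ^ i * genC * genA ^ (-i)

theorem evalAt_lift_conjC (g : ThompsonF) (v : FreeGroup ℤ) :
    evalAt g (FreeGroup.lift conjC v) = FreeGroup.lift (x0Conj g) v := by
  rw [← MonoidHom.comp_apply]
  congr 1
  ext1 i
  simp [conjC, x0Conj, evalAt_genA, evalAt_genC]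

/-- The canonical epimorphism onto the limit group. -/
def limitHom : FreeGroup (Fin 3) →* FreeGroup (Fin 3) ⧸ Subgroup.normalClosure limitRels :=
  QuotientGroup.mk' _

theorem limitHom_eq_one_iff {w : FreeGroup (Fin 3)} :
    limitHom w = 1 ↔ w ∈ Subgroup.normalClosure limitRels :=
  QuotientGroup.eq_one_iff w

theorem limitHom_eq_one_of_mem {w : FreeGroup (Fin 3)} (h : w ∈ limitRels) : limitHom w = 1 :=
  limitHom_eq_one_iff.2 (Subgroup.subset_normalClosure h)

/-- Conjugate by `aʲ` the relator that makes `aⁱ⁻ʲ c aʲ⁻ⁱ` commute with `c`. -/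
theorem limitHom_commute_conjC (i j : ℤ) :
    Commute (limitHom (conjC i)) (limitHom (conjC j)) := by
  have h : Commute (limitHom (conjC (i - j))) (limitHom genC) := by
    rw [← commutatorElement_eq_one_iff_commute, ← map_commutatorElement]
    exact limitHom_eq_one_of_mem (Or.inl (Or.inr ⟨i - j, rfl⟩))
  have h' := (Commute.conj_iff (limitHom genA ^ j)).2 h
  simp only [conjC, map_mul, map_zpow] at h' ⊢
  convert h' using 1
  · group
  · group

theorem limitHom_commute_genB_conjC (i : ℤ) :
    Commute (limitHom genB) (limitHom (conjC i)) := by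
  have h : Commute (limitHom (genA ^ (-i) * genB * genA ^ (- -i))) (limitHom genC) := by
    rw [← commutatorElement_eq_one_iff_commute, ← map_commutatorElement]
    exact limitHom_eq_one_of_mem (Or.inr ⟨-i, rfl⟩)
  have h' := (Commute.conj_iff (limitHom genA ^ i)).2 h
  simp only [conjC, map_mul, map_zpow] at h' ⊢
  convert h' using 1
  · group
  · group

theorem limitHom_commute_genB_lift (v : FreeGroup ℤ) :
    Commute (limitHom genB) (limitHom (FreeGroup.lift conjC v)) := by
  induction v using FreeGroup.induction_on with
  | C1 => simp
  | of i => simpa using limitHom_commute_genB_conjC i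
  | inv_of i hi => simpa using hi
  | mul v w hv hw => rw [map_mul, map_mul]; exact hv.mul_right hw

/-- Conjugation by `aᵏ` shifts the indices of the `aⁱ c a⁻ⁱ` by `k`, already in the free group. -/
theorem genA_zpow_mul_lift (k : ℤ) (v : FreeGroup ℤ) :
    genA ^ k * FreeGroup.lift conjC v
      = FreeGroup.lift conjC (FreeGroup.map (k + ·) v) * genA ^ k := by
  have h : (MulAut.conj (genA ^ k)).toMonoidHom.comp (FreeGroup.lift conjC)
      = (FreeGroup.lift conjC).comp (FreeGroup.map (k + ·)) := by
    ext1 i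
    simp [conjC, zpow_add, mul_assoc, -map_zpow]
  have h' := DFunLike.congr_fun h v
  rw [MonoidHom.comp_apply, MonoidHom.comp_apply] at h'
  rw [← h']
  simp [-map_zpow]

/-- Every element of the limit group is the product of a word in the conjugates `aⁱ c a⁻ⁱ` and a
word in `a` and `b`. -/
theorem exists_limit_normalForm (w : FreeGroup (Fin 3)) :
    ∃ (v : FreeGroup ℤ) (u : FreeGroup (Fin 2)),
      limitHom w = limitHom (FreeGroup.lift conjC v * wordInAB u) := by
  have hA : wordInAB (FreeGroup.of 0) = genA := by simp [wordInAB]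
  have hB : wordInAB (FreeGroup.of 1) = genB := by simp [wordInAB]
  have hC : FreeGroup.lift conjC (FreeGroup.of 0) = genC := by simp [conjC]
  -- The normal forms are stable under left multiplication by each generator: `a` shifts the
  -- conjugates, `b` commutes with them, and `c` is the conjugate of index `0`.
  have stepA : ∀ (k : ℤ) v u, ∃ v' u', limitHom (genA ^ k * (FreeGroup.lift conjC v * wordInAB u))
      = limitHom (FreeGroup.lift conjC v' * wordInAB u') := fun k v u =>
    ⟨FreeGroup.map (k + ·) v, FreeGroup.of 0 ^ k * u, by
      rw [← mul_assoc, genA_zpow_mul_lift, map_mul wordInAB, map_zpow, hA, mul_assoc]⟩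
  have stepB : ∀ (k : ℤ) v u, ∃ v' u', limitHom (genB ^ k * (FreeGroup.lift conjC v * wordInAB u))
      = limitHom (FreeGroup.lift conjC v' * wordInAB u') := fun k v u =>
    ⟨v, FreeGroup.of 1 ^ k * u, by
      have h := ((limitHom_commute_genB_lift v).zpow_left k).eq
      simp only [map_mul, map_zpow, hB]
      rw [← mul_assoc, h, mul_assoc]⟩
  have stepC : ∀ (k : ℤ) v u, ∃ v' u', limitHom (genC ^ k * (FreeGroup.lift conjC v * wordInAB u))
      = limitHom (FreeGroup.lift conjC v' * wordInAB u') := fun k v u =>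
    ⟨FreeGroup.of 0 ^ k * v, u, by
      rw [map_mul (FreeGroup.lift conjC), map_zpow, hC, mul_assoc]⟩
  have step : ∀ (i : Fin 3) (k : ℤ) v u, ∃ v' u',
      limitHom (FreeGroup.of i ^ k * (FreeGroup.lift conjC v * wordInAB u))
        = limitHom (FreeGroup.lift conjC v' * wordInAB u') := by
    intro i
    fin_cases i
    · exact stepA
    · exact stepB
    · exact stepC
  obtain ⟨l, rfl⟩ : ∃ l, FreeGroup.mk l = w := ⟨_, FreeGroup.mk_toWord⟩
  induction l with
  | nil => exact ⟨1, 1, by simp [← FreeGroup.one_eq_mk]⟩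
  | cons x l ih =>
    obtain ⟨i, s⟩ := x
    obtain ⟨v, u, h⟩ := ih
    have hx : FreeGroup.mk [(i, s)] = FreeGroup.of i ^ (if s then 1 else -1 : ℤ) := by
      cases s
      · simp [FreeGroup.of, FreeGroup.inv_mk, FreeGroup.invRev]
      · simp [FreeGroup.of]
    rw [← List.singleton_append, ← FreeGroup.mul_mk, map_mul, h, ← map_mul, hx]
    exact step i _ v u

/-! ### Convergence -/

section Sequence

variable {g : ℕ → ThompsonF} {r s : ℕ → ℝ}

/-- The threshold for a relator depends on its index `i`, so there is none for all relators at once;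
but a consequence uses only finitely many of them. -/
theorem eventually_evalAt_eq_one (hsr : ∀ n, s n < 2 * r n) (hs : Tendsto s atTop (𝓝 0))
    (hsupp : ∀ n, thompsonSupport (g n) ⊆ Set.Icc (r n) (s n)) {w : FreeGroup (Fin 3)}
    (hw : limitHom w = 1) : ∀ᶠ n in atTop, evalAt (g n) w = 1 := by
  have hrel : ∀ x ∈ limitRels, ∀ᶠ n in atTop, evalAt (g n) x = 1 := by
    intro x hx
    rcases hx with ((rfl | rfl) | ⟨i, rfl⟩) | ⟨i, rfl⟩
    · exact Eventually.of_forall fun n => evalAt_relR1 _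
    · exact Eventually.of_forall fun n => evalAt_relR2 _
    · filter_upwards [hs.eventually_le_const (by norm_num : (0 : ℝ) < 1 / 2)] with n hn
      rw [map_commutatorElement, commutatorElement_eq_one_iff_commute]
      simp only [map_mul, map_zpow, evalAt_genA, evalAt_genC]
      exact commute_x0Conj (hsupp n) (hsr n) hn i
    · have hpos : (0 : unitInterval) < dyadicPoint 1 := by
        rw [← Subtype.coe_lt_coe, coe_dyadicPoint_one]
        norm_num
      filter_upwards [hs.eventually_le_const
        (Subtype.coe_lt_coe.2 (thompsonPerm_pos (thompsonX0 ^ i) hpos))] with n hn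
      rw [map_commutatorElement, commutatorElement_eq_one_iff_commute]
      simp only [map_mul, map_zpow, evalAt_genA, evalAt_genB, evalAt_genC]
      exact commute_x0Conj_x1 (hsupp n) hn
  rw [limitHom_eq_one_iff, Subgroup.normalClosure] at hw
  induction hw using Subgroup.closure_induction with
  | mem x hx =>
    obtain ⟨y, hy, hyx⟩ := Group.mem_conjugatesOfSet_iff.1 hx
    obtain ⟨k, rfl⟩ := isConj_iff.1 hyx
    filter_upwards [hrel y hy] with n hn
    rw [map_mul, map_mul, hn, map_inv, mul_one, mul_inv_cancel]
  | one => simp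
  | mul x y _ _ hx hy =>
    filter_upwards [hx, hy] with n h1 h2
    rw [map_mul, h1, h2, mul_one]
  | inv x _ hx =>
    filter_upwards [hx] with n h1
    rw [map_inv, h1, inv_one]

/-- For each letter `i` of `v`, the point `x₀⁻ⁱ(y)` is positive and independent of `n`, so it
eventually lies to the right of `[rₙ, sₙ]`. -/
theorem eventually_lift_x0Conj_fix (hs : Tendsto s atTop (𝓝 0))
    (hsupp : ∀ n, thompsonSupport (g n) ⊆ Set.Icc (r n) (s n)) (v : FreeGroup ℤ)
    {y : unitInterval} (hy : 0 < y) :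
    ∀ᶠ n in atTop, thompsonPerm (FreeGroup.lift (x0Conj (g n)) v) y = y := by
  induction v using FreeGroup.induction_on with
  | C1 => simp
  | of i =>
    filter_upwards [hs.eventually_lt_const
      (Subtype.coe_lt_coe.2 (thompsonPerm_pos (thompsonX0 ^ (-i)) hy))] with n hn
    rw [FreeGroup.lift_apply_of]
    exact x0Conj_fix (hsupp n) hn
  | inv_of i hi =>
    filter_upwards [hi] with n hn
    rw [map_inv, map_inv, Equiv.Perm.inv_eq_iff_eq, hn]
  | mul v w hv hw =>
    filter_upwards [hv, hw] with n h1 h2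
    rw [map_mul, map_mul, Equiv.Perm.mul_apply, h2, h1]

theorem limitHom_eq_one_of_frequently (hsr : ∀ n, s n < 2 * r n) (hs : Tendsto s atTop (𝓝 0))
    (hsupp : ∀ n, thompsonSupport (g n) ⊆ Set.Icc (r n) (s n)) (hg : ∀ n, g n ≠ 1)
    {w : FreeGroup (Fin 3)} (hw : ∃ᶠ n in atTop, evalAt (g n) w = 1) : limitHom w = 1 := by
  obtain ⟨v, u, h⟩ := exists_limit_normalForm w
  have hev : ∀ᶠ n in atTop,
      evalAt (g n) w = FreeGroup.lift (x0Conj (g n)) v * evalInF u := by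
    have h' : limitHom (w * (FreeGroup.lift conjC v * wordInAB u)⁻¹) = 1 := by
      rw [map_mul, map_inv, h, mul_inv_cancel]
    filter_upwards [eventually_evalAt_eq_one hsr hs hsupp h'] with n hn
    rw [map_mul, map_inv, mul_inv_eq_one] at hn
    rw [hn, map_mul, evalAt_lift_conjC, evalAt_wordInAB]
  have hu : evalInF u = 1 := by
    refine thompsonPerm_injective (Equiv.ext fun x => ?_)
    rw [map_one, Equiv.Perm.one_apply]
    rcases eq_or_lt_of_le (unitInterval.nonneg' (t := x)) with rfl | hx
    · exact thompsonPerm_zero _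
    -- For a suitable `n` the conjugate part fixes the image of `x` under `u(x₀, x₁)`, while its
    -- product with `u(x₀, x₁)` is the identity; hence `x` equals its image.
    · obtain ⟨n, hn1, hn2, hn3⟩ := (hw.and_eventually (hev.and
        (eventually_lift_x0Conj_fix hs hsupp v (thompsonPerm_pos (evalInF u) hx)))).exists
      rw [hn1] at hn2
      rw [← Equiv.Perm.mul_apply, ← map_mul, ← hn2, map_one, Equiv.Perm.one_apply] at hn3
      exact hn3.symm
  obtain ⟨n, hn1, hn2, hn3⟩ := (hw.and_eventually (hev.and
    (hs.eventually_le_const (by norm_num : (0 : ℝ) < 1 / 2)))).exists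
  rw [hn1, hu, mul_one] at hn2
  have hv := exponentSum_eq_zero_of_lift_x0Conj_eq_one (hg n) (hsupp n) (hsr n) hn3 hn2.symm
  have hlift : limitHom (FreeGroup.lift conjC v)
      = FreeGroup.lift (fun i => limitHom (conjC i)) v := by
    rw [← MonoidHom.comp_apply]
    congr 1
    ext1 i
    simp
  rw [h, map_mul, hlift, lift_eq_one_of_exponentSum_eq_zero limitHom_commute_conjC hv, one_mul,
    limitHom_eq_one_iff]
  exact wordInAB_mem_of_evalInF_eq_one (Subgroup.subset_normalClosure (by simp [limitRels]))
    (Subgroup.subset_normalClosure (by simp [limitRels])) hu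

end Sequence

/-- Convergence of marked groups is eventual agreement on each relation. -/
theorem tendsto_markedSpace {k : ℕ} {X : ℕ → MarkedSpace k} {Y : MarkedSpace k}
    (h : ∀ w, ∀ᶠ n in atTop, (w ∈ (X n).relations ↔ w ∈ Y.relations)) :
    Tendsto X atTop (𝓝 Y) := by
  rw [Metric.tendsto_atTop']
  intro ε hε
  obtain ⟨R, hR⟩ := ((Real.tendsto_exp_neg_atTop_nhds_zero.comp
    tendsto_natCast_atTop_atTop).eventually_lt_const hε).exists
  -- Finitely many words have length at most `R`, so their thresholds have a common bound.
  have hfin : {w : FreeGroup (Fin k) | w.norm ≤ R}.Finite :=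
    (List.finite_length_le (Fin k × Bool) R).preimage FreeGroup.toWord_injective.injOn
  obtain ⟨N, hN⟩ := eventually_atTop.1 ((hfin.eventually_all).2 fun w _ => h w)
  exact ⟨N, fun n hn => (((X n).distance_le_iff Y R).2 fun w hw => hN n hn.le w hw).trans_lt hR⟩

theorem theorem4p4 (g : ℕ → ThompsonF) (r s : ℕ → ℝ) (w : ℕ → FreeGroup (Fin 2))
    (hI : ∀ n, Set.Icc (r n) (s n) ⊆ Set.Icc 0 1)
    (hrs : ∀ n, r n < s n) (hsr : ∀ n, s n < 2 * r n)
    (hr : Tendsto r atTop (𝓝 0))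
    (hsupp : ∀ n, thompsonSupport (g n) ⊆ Set.Icc (r n) (s n))
    (hg : ∀ n, g n ≠ 1)
    (hw : ∀ n, evalInF (w n) = g n) :
    Tendsto (fun n => markedOfWord (w n)) atTop (𝓝 limitMarked) := by
  have hs : Tendsto s atTop (𝓝 0) :=
    tendsto_of_tendsto_of_tendsto_of_le_of_le hr (by simpa using hr.const_mul 2)
      (fun n => (hrs n).le) fun n => (hsr n).le
  refine tendsto_markedSpace fun v => ?_
  have hlim : v ∈ limitMarked.relations ↔ limitHom v = 1 :=
    mem_relations_presentedMarked.trans limitHom_eq_one_iff.symm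
  simp only [mem_relations_markedOfWord, hw, hlim]
  by_cases h : limitHom v = 1
  · filter_upwards [eventually_evalAt_eq_one hsr hs hsupp h] with n hn
    simp [h, hn]
  -- A word nontrivial in the limit cannot be trivial for infinitely many `n`, so it is eventually
  -- nontrivial.
  · have h' := mt (limitHom_eq_one_of_frequently hsr hs hsupp hg) h
    filter_upwards [not_frequently.1 h'] with n hn
    simp [h, hn]
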